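/- Let $-\infty\le m<M<+\infty$, let $\mathcal I=\overline{(m,M)}\subset\mathbb R$ (so $\mathcal I=[m,M]$ if $m>-\infty$ and $\mathcal I=(-\infty,M]$ if $m=-\infty$), and let $\{W_n:n\ge1\}$ be i.i.d. real random variables with a probability density $f\ge 0$ that is positive on $(m,M)$ and vanishes outside $\mathcal I$. Put $F(z)=\int_{-\infty}^z f(w)\,dw$ and, for $z\in\mathcal I$ and $\theta\in\mathbb R$, $$\kappa_{Y|Z}(\theta|z)=\begin{cases}\theta m&\text{if } z=m>-\infty,\\[2pt] \log\dfrac{\int_{-\infty}^z e^{\theta w}f(w)\,dw}{F(z)}\in(-\infty,\infty]&\text{otherwise.}\end{cases}$$ Assume that for every $z\in\mathcal I$ the function $\kappa_{Y|Z}(\cdot|z)$ is finite in a neighborhood of $0$, lower semicontinuous and essentially smooth. (A function $\Lambda:\mathbb R\to(-\infty,\infty]$ with domain $\mathcal D=\{\Lambda<\infty\}$ is essentially smooth if $\mathcal D^\circ\ne\emptyset$, $\Lambda$ is differentiable on $\mathcal D^\circ$, and $|\Lambda'(\theta_n)|\to\infty$ whenever $\theta_n\in\mathcal D^\circ$ converges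 to a boundary point of $\mathcal D$.) Define, for $y,z\in\mathcal I$, $$I_Z(z)=-\log F(z)\ \ (\log 0=-\infty),\qquad I_{Y|Z}(y|z)=\sup_{\theta\in\mathbb R}\{\theta y-\kappa_{Y|Z}(\theta|z)\},$$ $$I_{Y,Z}(y,z)=I_{Y|Z}(y|z)+I_Z(z),\qquad I_Y(y)=\inf_{z\in\mathcal I}I_{Y,Z}(y,z),$$ and, for $n\ge1$, $Y_n=\frac{W_1+\cdots+W_n}{n}$, $Z_n=\max\{W_1,\dots,W_n\}$; let $\pi_n=P((Y_n,Z_n)\in\cdot)$, a probability measure on $\mathcal I\times\mathcal I$. Then $\{\pi_n:n\ge1\}$ satisfies the weak large deviation principle on $\mathcal I\times\mathcal I$ with speed $n$ and rate function $I_{Y,Z}$, that is, $I_{Y,Z}$ is lower semicontinuous with values in $[0,\infty]$, $$\liminf_{n\to\infty}\frac1n\log\pi_n(O)\ge-\inf_{O}I_{Y,Z}\quad\text{for every open } O\subset\mathcal I\times\mathcal I,$$ $$\limsup_{n\to\infty}\frac1n\log\pi_n(K)\le-\inf_{K}I_{Y,Z}\quad\text{for every compact } K\subset\mathcal I\times\mathcal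 I.$$ Moreover, if the rate function $I_{Y,Z}$ is good (i.e. $\{I_{Y,Z}\le\eta\}$ is compact for every $\eta\ge0$), then $\{\pi_n:n\ge1\}$ satisfies the full large deviation principle with speed $n$ and rate function $I_{Y,Z}$ (the upper bound holds for every closed subset of $\mathcal I\times\mathcal I$), and $I_Y$ is also a good rate function on $\mathcal I$. -/

import Mathlib

open Filter Topology MeasureTheory ProbabilityTheory

namespace SumMaxLDP

noncomputable section

/-! ### Large deviation principles -/

/-- `(1 / v) log p`, an extended real number (with `log 0 = -∞`). -/
def scaledLog (v : ℝ) (p : ENNReal) : EReal :=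
  ((v⁻¹ : ℝ) : EReal) * ENNReal.log p

/-- A rate function: lower semicontinuous with values in `[0, ∞]`. -/
def IsRateFunction {X : Type*} [TopologicalSpace X] (I : X → EReal) : Prop :=
  (∀ x, 0 ≤ I x) ∧ LowerSemicontinuous I

/-- A good rate function: a rate function all of whose level sets are compact. -/
def IsGoodRateFunction {X : Type*} [TopologicalSpace X] (I : X → EReal) : Prop :=
  IsRateFunction I ∧ ∀ η : ℝ, 0 ≤ η → IsCompact {x | I x ≤ (η : EReal)}

/-- What the LDP and the weak LDP of the sequence `π 1, π 2, …` of probability measures with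
speed `v` and rate function `I` have in common, in particular the lower bound for open sets. -/
def LDPLowerPart {X : Type*} [TopologicalSpace X] [MeasurableSpace X]
    (π : ℕ → Measure X) (v : ℕ → ℝ) (I : X → EReal) : Prop :=
  (∀ n, 1 ≤ n → IsProbabilityMeasure (π n)) ∧
  Tendsto v atTop atTop ∧
  IsRateFunction I ∧
  ∀ O : Set X, IsOpen O →
    -(⨅ x ∈ O, I x) ≤ liminf (fun n => scaledLog (v n) (π n O)) atTop

/-- The (full) large deviation principle: the upper bound holds for closed sets. -/
def LDP {X : Type*} [TopologicalSpace X] [MeasurableSpace X]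
    (π : ℕ → Measure X) (v : ℕ → ℝ) (I : X → EReal) : Prop :=
  LDPLowerPart π v I ∧
  ∀ C : Set X, IsClosed C →
    limsup (fun n => scaledLog (v n) (π n C)) atTop ≤ -(⨅ x ∈ C, I x)

/-- The weak large deviation principle: the upper bound holds for compact sets. -/
def WeakLDP {X : Type*} [TopologicalSpace X] [MeasurableSpace X]
    (π : ℕ → Measure X) (v : ℕ → ℝ) (I : X → EReal) : Prop :=
  LDPLowerPart π v I ∧
  ∀ K : Set X, IsCompact K →
    limsup (fun n => scaledLog (v n) (π n K)) atTop ≤ -(⨅ x ∈ K, I x)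

/-! ### Essential smoothness -/

/-- The effective domain of an extended real valued function. -/
def effDomain (L : ℝ → EReal) : Set ℝ := {θ | L θ < ⊤}

/-- `L` is essentially smooth: the interior of its domain is nonempty, `L` is (finite and)
differentiable there, and `L` is steep. -/
def EssentiallySmooth (L : ℝ → EReal) : Prop :=
  (interior (effDomain L)).Nonempty ∧
  (∀ θ ∈ interior (effDomain L),
    L θ ≠ ⊥ ∧ DifferentiableAt ℝ (fun t => (L t).toReal) θ) ∧
  ∀ (u : ℕ → ℝ) (θ₀ : ℝ), (∀ n, u n ∈ interior (effDomain L)) →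
    θ₀ ∈ frontier (effDomain L) → Tendsto u atTop (𝓝 θ₀) →
    Tendsto (fun n => |deriv (fun t => (L t).toReal) (u n)|) atTop atTop

/-! ### The objects attached to the density -/

/-- The closure in `ℝ` of the interval `(m, M)`, where `-∞ ≤ m < M < ∞`: it is `[m, M]` if
`m > -∞` and `(-∞, M]` if `m = -∞`. -/
def clInterval (m : EReal) (M : ℝ) : Set ℝ := {x : ℝ | m ≤ (x : EReal) ∧ x ≤ M}

/-- The distribution function `F z = ∫_{-∞}^z f(w) dw` of the density `f`. -/
def cdfOf (f : ℝ → ℝ) (z : ℝ) : ENNReal :=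
  ∫⁻ w in Set.Iic z, ENNReal.ofReal (f w)

open Classical in
/-- The conditional log moment generating function `κ(θ | z)`: it is `θ m` if `z = m > -∞`, and
`log (∫_{-∞}^z e^{θ w} f(w) dw / F z)` otherwise. -/
def kappa (m : EReal) (f : ℝ → ℝ) (z θ : ℝ) : EReal :=
  if (z : EReal) = m then ((θ * z : ℝ) : EReal)
  else ENNReal.log
    ((∫⁻ w in Set.Iic z, ENNReal.ofReal (Real.exp (θ * w) * f w)) / cdfOf f z)

/-- `I_Z(z) = -log F(z)`, with `log 0 = -∞`. -/
def rateZ (f : ℝ → ℝ) (z : ℝ) : EReal := -ENNReal.log (cdfOf f z)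

/-- `I_{Y|Z}(y | z) = sup_θ {θ y - κ(θ | z)}`. -/
def rateYgivenZ (m : EReal) (f : ℝ → ℝ) (y z : ℝ) : EReal :=
  ⨆ θ : ℝ, (((θ * y : ℝ) : EReal) - kappa m f z θ)

/-- `I_{Y,Z}(y, z) = I_{Y|Z}(y | z) + I_Z(z)` for `y` and `z` in the closed interval. -/
def rateYZ (m : EReal) (M : ℝ) (f : ℝ → ℝ)
    (p : clInterval m M × clInterval m M) : EReal :=
  rateYgivenZ m f p.1 p.2 + rateZ f p.2

/-- `I_Y(y) = inf_z I_{Y,Z}(y, z)`, for `y` and `z` in the closed interval. -/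
def rateY (m : EReal) (M : ℝ) (f : ℝ → ℝ) (y : clInterval m M) : EReal :=
  ⨅ z : clInterval m M, rateYZ m M f (y, z)

/-! ### Sample mean and sample maximum -/

/-- The mean of the first `n` variables (used for `n ≥ 1`). -/
def sampleMean {Ω : Type*} (W : ℕ → Ω → ℝ) (n : ℕ) (ω : Ω) : ℝ :=
  (∑ i ∈ Finset.range n, W i ω) / n

/-- The maximum of the first `n` variables (used for `n ≥ 1`). -/
def sampleMax {Ω : Type*} (W : ℕ → Ω → ℝ) (n : ℕ) (ω : Ω) : ℝ :=
  ⨆ i : Fin n, W i ω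

/-- The law of (sample mean, sample maximum), as a measure on the square of the closed interval,
on which it is concentrated: the measure of `A` is `P ((Y_n, Z_n) ∈ A)`. -/
def jointLaw {Ω : Type*} [MeasurableSpace Ω] (P : Measure Ω) (W : ℕ → Ω → ℝ)
    (m : EReal) (M : ℝ) (n : ℕ) : Measure (clInterval m M × clInterval m M) :=
  (P.map (fun ω => (sampleMean W n ω, sampleMax W n ω))).comap
    (fun p => ((p.1 : ℝ), (p.2 : ℝ)))

end

end SumMaxLDP

/-!
Write `G θ z = ∫_{-∞}^z e^{θ w} f(w) dw` (`partialMGF`). Conditioning on `W ≤ z` divides `G` by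
`F z`, and the term `-log F z` of the rate function undoes this division, so that the rate at
`(y, z)` is the Legendre transform `sup_θ (θ y - log G θ z)` (`rateYZ_eq_legendreRate`). At the left
endpoint `z = m` both sides are `+∞`, because `G` vanishes there. As `G θ` is continuous, the rate
function is a supremum of continuous functions, hence lower semicontinuous.

*Upper bound.* On the event that the maximum is at most `b`, Markov's inequality and independence
bound the probability that `θ Y_n ≥ c` by `(e^{-c} G θ b) ^ n` (`measure_sum_ge_le`). With `b`
slightly above `z` and `c` slightly below `θ y` this is the upper bound near `(y, z)`, and a finite
cover gives it on compact sets. A negative `θ` with `G θ M` finite controls the lower tail of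
`Y_n`, and also that of `Z_n` since `Y_n ≤ Z_n`; this exponential tightness extends the bound to
closed sets (`exists_jointLaw_tail_le`).

*Lower bound.* Let `(y, z)` have rate less than `a`. Put the last variable just below `z`, at the
cost of a constant factor, and ask the others to be at most `z` with mean near `y`
(`eventually_le_jointLaw`). This is the lower bound of Cramér's theorem for the law restricted to
`(-∞, z]` (`eventually_le_measure_nearMeanEvent`). The finite rate forces mass on both sides of `y`.
Restricting further to a large interval `[-R, R]` makes the moment generating function about `y`
smooth and coercive, and a Dini argument keeps its minimum above `e^{-a}`
(`exists_truncMGF_critical`). The minimiser `θ` is the tilting parameter. That the tilted mean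
concentrates at `y` follows from the Chernoff bound: moving `θ` by `± s` changes the moment
generating function only to second order, while the deviation by `δ` gains a factor `e^{-s δ}` per
variable (`exists_pos_truncMGF_mul_exp_lt`, `tiltWeight_le`).

The statement on `I_Y` is the contraction principle for the first projection
(`IsGoodRateFunction.iInf_snd`).
-/

namespace SumMaxLDP

/-! ### Exponential bounds and scaled logarithms -/

lemma scaledLog_le_coe_iff {n : ℕ} (hn : 0 < n) {p : ENNReal} {a : ℝ} :
    scaledLog n p ≤ (a : EReal) ↔ p ≤ ENNReal.ofReal (Real.exp (n * a)) := by
  have hn' : (0 : ℝ) < n := by exact_mod_cast hn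
  rw [← ENNReal.log_le_log_iff, ENNReal.log_ofReal_of_pos (Real.exp_pos _), Real.log_exp,
    scaledLog]
  induction ENNReal.log p using EReal.rec with
  | bot => simp [EReal.coe_mul_bot_of_pos (inv_pos.2 hn')]
  | top => simp only [EReal.coe_mul_top_of_pos (inv_pos.2 hn'), top_le_iff, EReal.coe_ne_top]
  | coe x =>
    rw [← EReal.coe_mul, EReal.coe_le_coe_iff, EReal.coe_le_coe_iff, inv_mul_le_iff₀ hn']

lemma coe_le_scaledLog_iff {n : ℕ} (hn : 0 < n) {p : ENNReal} {a : ℝ} :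
    (a : EReal) ≤ scaledLog n p ↔ ENNReal.ofReal (Real.exp (n * a)) ≤ p := by
  have hn' : (0 : ℝ) < n := by exact_mod_cast hn
  rw [← ENNReal.log_le_log_iff, ENNReal.log_ofReal_of_pos (Real.exp_pos _), Real.log_exp,
    scaledLog]
  induction ENNReal.log p using EReal.rec with
  | bot => simp only [EReal.coe_mul_bot_of_pos (inv_pos.2 hn'), le_bot_iff, EReal.coe_ne_bot]
  | top => simp only [EReal.coe_mul_top_of_pos (inv_pos.2 hn'), le_top]
  | coe x =>
    rw [← EReal.coe_mul, EReal.coe_le_coe_iff, EReal.coe_le_coe_iff, le_inv_mul_iff₀ hn']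

lemma limsup_scaledLog_le {p : ℕ → ENNReal} {I : EReal}
    (h : ∀ a : ℝ, (a : EReal) < I → ∀ᶠ n : ℕ in atTop,
      p n ≤ ENNReal.ofReal (Real.exp (n * -a))) :
    limsup (fun n : ℕ => scaledLog n (p n)) atTop ≤ -I := by
  rw [EReal.le_neg]
  refine EReal.ge_of_forall_gt_iff_ge.1 fun a ha => ?_
  rw [EReal.le_neg, ← EReal.coe_neg]
  refine limsup_le_of_le (by isBoundedDefault) ?_
  filter_upwards [h a ha, eventually_gt_atTop 0] with n hn hn0
  exact (scaledLog_le_coe_iff hn0).2 hn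

lemma le_liminf_scaledLog {p : ℕ → ENNReal} {I : EReal}
    (h : ∀ a : ℝ, I < (a : EReal) → ∀ᶠ n : ℕ in atTop,
      ENNReal.ofReal (Real.exp (n * -a)) ≤ p n) :
    -I ≤ liminf (fun n : ℕ => scaledLog n (p n)) atTop := by
  rw [EReal.neg_le]
  refine EReal.le_of_forall_lt_iff_le.1 fun a ha => ?_
  rw [EReal.neg_le, ← EReal.coe_neg]
  refine le_liminf_of_le (by isBoundedDefault) ?_
  filter_upwards [h a ha, eventually_gt_atTop 0] with n hn hn0
  exact (coe_le_scaledLog_iff hn0).2 hn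

/-- Constant prefactors are invisible on the exponential scale. -/
lemma eventually_natCast_mul_exp_le (N : ℕ) {a b : ℝ} (hab : a < b) :
    ∀ᶠ n : ℕ in atTop, (N : ENNReal) * ENNReal.ofReal (Real.exp (n * -b)) ≤
      ENNReal.ofReal (Real.exp (n * -a)) := by
  have h1 : Tendsto (fun n : ℕ => Real.exp (n * (b - a))) atTop atTop :=
    Real.tendsto_exp_atTop.comp
      (tendsto_natCast_atTop_atTop.atTop_mul_const (sub_pos.2 hab))
  filter_upwards [h1.eventually_ge_atTop (N : ℝ)] with n hn
  rw [← ENNReal.ofReal_natCast, ← ENNReal.ofReal_mul (by positivity)]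
  refine ENNReal.ofReal_le_ofReal ?_
  calc (N : ℝ) * Real.exp (n * -b) ≤ Real.exp (n * (b - a)) * Real.exp (n * -b) := by gcongr
    _ = Real.exp (n * -a) := by rw [← Real.exp_add]; ring_nf

/-- Exponential bounds near each point of a compact set give an exponential bound on the set. -/
lemma eventually_measure_le_of_isCompact {X : Type*} [TopologicalSpace X] [MeasurableSpace X]
    {π : ℕ → Measure X} {K : Set X} (hK : IsCompact K) {a b : ℝ} (hab : a < b)
    (hloc : ∀ x ∈ K, ∃ U ∈ 𝓝 x, ∀ᶠ n : ℕ in atTop,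
      π n U ≤ ENNReal.ofReal (Real.exp (n * -b))) :
    ∀ᶠ n : ℕ in atTop, π n K ≤ ENNReal.ofReal (Real.exp (n * -a)) := by
  obtain ⟨N, hN⟩ : ∃ N : ℕ, ∀ᶠ n : ℕ in atTop,
      π n K ≤ N * ENNReal.ofReal (Real.exp (n * -b)) := by
    refine hK.induction_on (p := fun s => ∃ N : ℕ, ∀ᶠ n : ℕ in atTop,
      π n s ≤ N * ENNReal.ofReal (Real.exp (n * -b))) ⟨0, by simp⟩ ?_ ?_ ?_
    · rintro s t hst ⟨N, hN⟩
      exact ⟨N, hN.mono fun n hn => (measure_mono hst).trans hn⟩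
    · rintro s t ⟨N, hN⟩ ⟨N', hN'⟩
      refine ⟨N + N', ?_⟩
      filter_upwards [hN, hN'] with n h1 h2
      push_cast
      rw [add_mul]
      exact (measure_union_le s t).trans (add_le_add h1 h2)
    · intro x hx
      obtain ⟨U, hU, h⟩ := hloc x hx
      exact ⟨U, mem_nhdsWithin_of_mem_nhds hU, 1, by simpa using h⟩
  filter_upwards [hN, eventually_natCast_mul_exp_le N hab] with n h1 h2 using h1.trans h2

/-! ### Independence and exponential moments -/

lemma lintegral_prod_comp {Ω : Type*} [MeasurableSpace Ω] {P : Measure Ω}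
    {W : ℕ → Ω → ℝ} (hW : ∀ n, Measurable (W n)) (hind : iIndepFun W P) {ν : Measure ℝ}
    (hν : ∀ n, P.map (W n) = ν) (s : Finset ℕ) (g : ℕ → ℝ → ENNReal)
    (hg : ∀ i, Measurable (g i)) :
    ∫⁻ ω, ∏ i ∈ s, g i (W i ω) ∂P = ∏ i ∈ s, ∫⁻ w, g i w ∂ν := by
  rw [lintegral_prod_eq_prod_lintegral_of_indepFun s (fun i ω => g i (W i ω))
    (hind.comp g hg) (fun i => (hg i).comp (hW i))]
  refine Finset.prod_congr rfl fun i _ => ?_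
  rw [← hν i, lintegral_map (hg i) (hW i)]

/-- Chernoff's bound for the mean on the event that the maximum is at most `b`. -/
lemma measure_sum_ge_le {Ω : Type*} [MeasurableSpace Ω] {P : Measure Ω}
    {W : ℕ → Ω → ℝ} (hW : ∀ n, Measurable (W n)) (hind : iIndepFun W P) {ν : Measure ℝ}
    (hν : ∀ n, P.map (W n) = ν) (n : ℕ) (θ b c : ℝ) :
    P {ω | n * c ≤ θ * ∑ i ∈ Finset.range n, W i ω ∧ ∀ i < n, W i ω ≤ b} ≤
      (ENNReal.ofReal (Real.exp (-c)) *
        ∫⁻ w in Set.Iic b, ENNReal.ofReal (Real.exp (θ * w)) ∂ν) ^ n := by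
  set g : ℝ → ENNReal := fun w =>
    ENNReal.ofReal (Real.exp (-c)) * (Set.Iic b).indicator
      (fun w => ENNReal.ofReal (Real.exp (θ * w))) w with hg_def
  have hg : Measurable g := by
    refine Measurable.const_mul (Measurable.indicator ?_ measurableSet_Iic) _
    fun_prop
  have hint : ∫⁻ w, g w ∂ν = ENNReal.ofReal (Real.exp (-c)) *
      ∫⁻ w in Set.Iic b, ENNReal.ofReal (Real.exp (θ * w)) ∂ν := by
    rw [hg_def, lintegral_const_mul, lintegral_indicator measurableSet_Iic]
    refine Measurable.indicator ?_ measurableSet_Iic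
    fun_prop
  have hprod := lintegral_prod_comp hW hind hν (Finset.range n) (fun _ => g) (fun _ => hg)
  simp only [Finset.prod_const, Finset.card_range, hint] at hprod
  rw [← hprod]
  have hmarkov := mul_meas_ge_le_lintegral₀ (μ := P) (f := fun ω => ∏ i ∈ Finset.range n, g (W i ω))
    (Finset.measurable_fun_prod _ fun i _ => hg.comp (hW i)).aemeasurable 1
  rw [one_mul] at hmarkov
  refine (measure_mono ?_).trans hmarkov
  rintro ω ⟨h1, h2⟩
  have : ∏ i ∈ Finset.range n, g (W i ω) =
      ∏ i ∈ Finset.range n, ENNReal.ofReal (Real.exp (θ * W i ω - c)) := by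
    refine Finset.prod_congr rfl fun i hi => ?_
    have hi' : W i ω ∈ Set.Iic b := h2 i (Finset.mem_range.1 hi)
    rw [hg_def]
    simp only [Set.indicator_of_mem hi']
    rw [← ENNReal.ofReal_mul (by positivity), ← Real.exp_add]
    ring_nf
  rw [Set.mem_ofPred_eq, this, ← ENNReal.ofReal_prod_of_nonneg (fun _ _ => by positivity),
    ← Real.exp_sum, ENNReal.one_le_ofReal, Real.one_le_exp_iff, Finset.sum_sub_distrib, ← Finset.mul_sum]
  simp only [Finset.sum_const, Finset.card_range, nsmul_eq_mul]
  linarith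

/-- If `φ < 0` almost everywhere then `∫ exp (t φ)` takes arbitrarily small values. -/
lemma exists_lintegral_exp_mul_lt {α : Type*} [MeasurableSpace α] {μ : Measure α}
    [IsFiniteMeasure μ] {φ : α → ℝ} (hφ : Measurable φ) (hneg : ∀ᵐ x ∂μ, φ x < 0) {c : ENNReal}
    (hc : 0 < c) : ∃ t : ℝ, ∫⁻ x, ENNReal.ofReal (Real.exp (t * φ x)) ∂μ < c := by
  have : Tendsto (fun n : ℕ => ∫⁻ x, ENNReal.ofReal (Real.exp ((n : ℝ) * φ x)) ∂μ) atTop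
      (𝓝 (∫⁻ _, 0 ∂μ)) := by
    refine tendsto_lintegral_of_dominated_convergence (fun _ => 1) (fun n => by fun_prop)
      (fun n => ?_) (by simp) ?_
    · filter_upwards [hneg] with x hx
      rw [← ENNReal.ofReal_one]
      refine ENNReal.ofReal_le_ofReal (Real.exp_le_one_iff.2 ?_)
      exact mul_nonpos_of_nonneg_of_nonpos n.cast_nonneg hx.le
    · filter_upwards [hneg] with x hx
      rw [← ENNReal.ofReal_zero]
      refine ENNReal.tendsto_ofReal (Real.tendsto_exp_atBot.comp ?_)
      exact tendsto_natCast_atTop_atTop.atTop_mul_const_of_neg hx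
  rw [lintegral_zero] at this
  obtain ⟨n, hn⟩ := (this.eventually_lt_const hc).exists
  exact ⟨n, hn⟩

/-! ### Truncated exponential moments -/

/-- The moment generating function about `y` of the restriction of `μ` to `[-R, R]`. -/
noncomputable def truncMGF (μ : Measure ℝ) (y R : ℝ) : ℝ → ℝ :=
  mgf (fun w => w - y) (μ.restrict (Set.Icc (-R) R))

section truncMGF

variable {μ : Measure ℝ} [IsFiniteMeasure μ] {y R : ℝ}

lemma integrable_exp_mul_sub (θ : ℝ) :
    Integrable (fun w => Real.exp (θ * (w - y))) (μ.restrict (Set.Icc (-R) R)) := by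
  refine integrable_exp_mul_of_mem_Icc (a := -R - y) (b := R - y) (by fun_prop) ?_
  filter_upwards [ae_restrict_mem measurableSet_Icc] with w hw
  exact ⟨by linarith [hw.1], by linarith [hw.2]⟩

lemma differentiable_truncMGF : Differentiable ℝ (truncMGF μ y R) := fun θ =>
  (hasDerivAt_mgf (by
    have : integrableExpSet (fun w => w - y) (μ.restrict (Set.Icc (-R) R)) = Set.univ :=
      Set.eq_univ_of_forall fun θ => integrable_exp_mul_sub θ
    simp [this])).differentiableAt

lemma ofReal_truncMGF (θ : ℝ) : ENNReal.ofReal (truncMGF μ y R θ) =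
    ∫⁻ w in Set.Icc (-R) R, ENNReal.ofReal (Real.exp (θ * (w - y))) ∂μ :=
  ofReal_integral_eq_lintegral_ofReal (integrable_exp_mul_sub θ)
    (ae_of_all _ fun _ => (Real.exp_pos _).le)

lemma truncMGF_mono {R' : ℝ} (h : R ≤ R') (θ : ℝ) : truncMGF μ y R θ ≤ truncMGF μ y R' θ :=
  setIntegral_mono_set (integrable_exp_mul_sub θ)
    (ae_of_all _ fun _ => (Real.exp_pos _).le)
    (Set.Icc_subset_Icc (neg_le_neg h) h).eventuallyLE

lemma mul_exp_le_truncMGF {A : Set ℝ} (hA : MeasurableSet A) (hAR : A ⊆ Set.Icc (-R) R) {θ t : ℝ}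
    (ht : ∀ w ∈ A, t ≤ θ * (w - y)) : μ.real A * Real.exp t ≤ truncMGF μ y R θ := by
  calc μ.real A * Real.exp t = ∫ _ in A, Real.exp t ∂μ := by simp
    _ ≤ ∫ w in A, Real.exp (θ * (w - y)) ∂μ :=
        setIntegral_mono_on (integrable_const _)
          ((integrable_exp_mul_sub (R := R) θ).mono_measure (Measure.restrict_mono hAR le_rfl)) hA
          fun w hw => Real.exp_le_exp.2 (ht w hw)
    _ ≤ truncMGF μ y R θ := setIntegral_mono_set (integrable_exp_mul_sub θ)
          (ae_of_all _ fun _ => (Real.exp_pos _).le) hAR.eventuallyLE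

lemma exists_nat_measure_Icc_pos (h : μ (Set.Ioi y) ≠ 0) :
    ∃ n : ℕ, 0 < μ.real (Set.Icc (y + 1 / (n + 1 : ℝ)) n) := by
  by_contra! hcon
  refine h (measure_mono_null (t := ⋃ n : ℕ, Set.Icc (y + 1 / (n + 1 : ℝ)) n) ?_
    (measure_iUnion_null fun n => ?_))
  · intro w hw
    obtain ⟨k, hk⟩ := exists_nat_one_div_lt (sub_pos.2 (Set.mem_Ioi.1 hw))
    obtain ⟨j, hj⟩ := exists_nat_ge w
    refine Set.mem_iUnion.2 ⟨max k j, ?_, hj.trans (by exact_mod_cast le_max_right k j)⟩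
    have : (1 : ℝ) / ((max k j : ℕ) + 1) ≤ 1 / (k + 1) :=
      one_div_le_one_div_of_le (by positivity)
        (by gcongr; exact_mod_cast le_max_left k j)
    linarith
  · have := le_antisymm (hcon n) measureReal_nonneg
    rwa [measureReal_eq_zero_iff] at this

lemma exists_nat_measure_Icc_pos' (h : μ (Set.Iio y) ≠ 0) :
    ∃ n : ℕ, 0 < μ.real (Set.Icc (-n : ℝ) (y - 1 / (n + 1 : ℝ))) := by
  by_contra! hcon
  refine h (measure_mono_null (t := ⋃ n : ℕ, Set.Icc (-n : ℝ) (y - 1 / (n + 1 : ℝ))) ?_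
    (measure_iUnion_null fun n => ?_))
  · intro w hw
    obtain ⟨k, hk⟩ := exists_nat_one_div_lt (sub_pos.2 (Set.mem_Iio.1 hw))
    obtain ⟨j, hj⟩ := exists_nat_ge (-w)
    refine Set.mem_iUnion.2 ⟨max k j, ?_, ?_⟩
    · have : (j : ℝ) ≤ (max k j : ℕ) := by exact_mod_cast le_max_right k j
      linarith
    have : (1 : ℝ) / ((max k j : ℕ) + 1) ≤ 1 / (k + 1) :=
      one_div_le_one_div_of_le (by positivity)
        (by gcongr; exact_mod_cast le_max_left k j)
    linarith
  · have := le_antisymm (hcon n) measureReal_nonneg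
    rwa [measureReal_eq_zero_iff] at this

/-- With mass on both sides of `y`, the truncated moment generating functions about `y` are
eventually coercive. -/
lemma exists_tendsto_truncMGF_cocompact (hr : μ (Set.Ioi y) ≠ 0) (hl : μ (Set.Iio y) ≠ 0) :
    ∃ n : ℕ, ∀ R : ℝ, n ≤ R → Tendsto (truncMGF μ y R) (cocompact ℝ) atTop := by
  obtain ⟨n₁, h₁⟩ := exists_nat_measure_Icc_pos hr
  obtain ⟨n₂, h₂⟩ := exists_nat_measure_Icc_pos' hl
  obtain ⟨n₃, h₃⟩ := exists_nat_ge |y|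
  have hy := abs_le.1 h₃
  refine ⟨max (max n₁ n₂) n₃, fun R hR => ?_⟩
  push_cast at hR
  simp only [max_le_iff] at hR
  obtain ⟨⟨hR1, hR2⟩, hR3⟩ := hR
  have e₁ : (0 : ℝ) < 1 / (n₁ + 1 : ℝ) := by positivity
  have e₂ : (0 : ℝ) < 1 / (n₂ + 1 : ℝ) := by positivity
  rw [cocompact_eq_atBot_atTop, tendsto_sup]
  constructor
  · refine tendsto_atTop_mono' _ (f₁ := fun θ =>
      μ.real (Set.Icc (-n₂ : ℝ) (y - 1 / (n₂ + 1 : ℝ))) *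
        Real.exp (θ * -(1 / (n₂ + 1 : ℝ)))) ?_ ?_
    · filter_upwards [eventually_le_atBot 0] with θ hθ
      refine mul_exp_le_truncMGF measurableSet_Icc
        (Set.Icc_subset_Icc (by linarith) (by linarith)) fun w hw => ?_
      exact mul_le_mul_of_nonpos_left (by linarith [hw.2]) hθ
    · exact (Real.tendsto_exp_atTop.comp
        (tendsto_id.atBot_mul_const_of_neg (neg_lt_zero.2 e₂))).const_mul_atTop h₂
  · refine tendsto_atTop_mono' _ (f₁ := fun θ =>
      μ.real (Set.Icc (y + 1 / (n₁ + 1 : ℝ)) n₁) *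
        Real.exp (θ * (1 / (n₁ + 1 : ℝ)))) ?_ ?_
    · filter_upwards [eventually_ge_atTop 0] with θ hθ
      refine mul_exp_le_truncMGF measurableSet_Icc
        (Set.Icc_subset_Icc (by linarith) (by linarith)) fun w hw => ?_
      exact mul_le_mul_of_nonneg_left (by linarith [hw.1]) hθ
    · exact (Real.tendsto_exp_atTop.comp
        (tendsto_id.atTop_mul_const e₁)).const_mul_atTop h₁

/-- A lower bound for the full moment generating function passes to some truncation, uniformly in
`θ`, and the truncated function has a critical point. The uniformity is a Dini argument on a
compact level set. -/
lemma exists_truncMGF_critical (hr : μ (Set.Ioi y) ≠ 0) (hl : μ (Set.Iio y) ≠ 0) {c : ℝ}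
    (hc : ∀ θ : ℝ, ENNReal.ofReal c < ∫⁻ w, ENNReal.ofReal (Real.exp (θ * (w - y))) ∂μ) :
    ∃ R θ : ℝ, deriv (truncMGF μ y R) θ = 0 ∧ c < truncMGF μ y R θ := by
  obtain ⟨N, hN⟩ := exists_tendsto_truncMGF_cocompact hr hl
  have hcompact : IsCompact {θ | truncMGF μ y N θ ≤ c} := by
    obtain ⟨t, ht, hsub⟩ := mem_cocompact.1 ((hN N le_rfl).eventually_gt_atTop c)
    refine ht.of_isClosed_subset
      (isClosed_le differentiable_truncMGF.continuous continuous_const) fun θ hθ => ?_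
    by_contra hθt
    exact absurd (show c < truncMGF μ y N θ from hsub hθt) (not_lt.2 hθ)
  have hmono : Monotone fun n : ℕ => {θ | c < truncMGF μ y n θ} := fun n k hnk θ hθ =>
    lt_of_lt_of_le hθ (truncMGF_mono (by exact_mod_cast hnk) θ)
  have hcover : {θ | truncMGF μ y N θ ≤ c} ⊆ ⋃ n : ℕ, {θ | c < truncMGF μ y n θ} := by
    intro θ _
    have hU : (⋃ n : ℕ, Set.Icc (-n : ℝ) n) = Set.univ := Set.eq_univ_of_forall fun w => by
      obtain ⟨n, hn⟩ := exists_nat_ge |w|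
      exact Set.mem_iUnion.2 ⟨n, abs_le.1 hn⟩
    have h := hc θ
    rw [← setLIntegral_univ, ← hU, setLIntegral_iUnion_of_directed _ (Monotone.directed_le
      fun n k hnk => Set.Icc_subset_Icc (by simpa using hnk) (by simpa using hnk)),
      lt_iSup_iff] at h
    obtain ⟨n, hn⟩ := h
    rw [← ofReal_truncMGF] at hn
    exact Set.mem_iUnion.2 ⟨n, (ENNReal.ofReal_lt_ofReal_iff'.1 hn).1⟩
  obtain ⟨k, hk⟩ := hcompact.elim_directed_cover _
    (fun n : ℕ => isOpen_lt continuous_const differentiable_truncMGF.continuous) hcover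
    hmono.directed_le
  have hNk : (N : ℝ) ≤ (max N k : ℕ) := by exact_mod_cast le_max_left N k
  have hkk : (k : ℝ) ≤ (max N k : ℕ) := by exact_mod_cast le_max_right N k
  obtain ⟨θ, hθ⟩ := (differentiable_truncMGF (μ := μ) (y := y)
    (R := (max N k : ℕ))).continuous.exists_forall_le (hN _ hNk)
  refine ⟨(max N k : ℕ), θ, IsLocalMin.deriv_eq_zero (Eventually.of_forall hθ), ?_⟩
  by_cases h : truncMGF μ y N θ ≤ c
  · exact lt_of_lt_of_le (hk h) (truncMGF_mono hkk θ)
  · exact lt_of_lt_of_le (not_le.1 h) (truncMGF_mono hNk θ)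

/-- At a critical point `θ`, a small change of `θ` in either direction changes the moment
generating function by less than the factor `exp (s δ)`. -/
lemma exists_pos_truncMGF_mul_exp_lt {θ δ : ℝ} (hδ : 0 < δ)
    (hd : deriv (truncMGF μ y R) θ = 0) (hpos : 0 < truncMGF μ y R θ) :
    ∃ s > 0, truncMGF μ y R (θ + s) * Real.exp (-s * δ) < truncMGF μ y R θ ∧
      truncMGF μ y R (θ - s) * Real.exp (-s * δ) < truncMGF μ y R θ := by
  have hda : HasDerivAt (truncMGF μ y R) 0 θ := hd ▸ (differentiable_truncMGF θ).hasDerivAt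
  have key : ∀ σ : ℝ, ∀ᶠ s in 𝓝[>] (0 : ℝ),
      truncMGF μ y R (θ + σ * s) * Real.exp (-s * δ) < truncMGF μ y R θ := by
    intro σ
    have h1 : HasDerivAt (fun s : ℝ => truncMGF μ y R (θ + σ * s)) (0 * σ) 0 := by
      refine HasDerivAt.comp (h₂ := truncMGF μ y R) (h := fun s => θ + σ * s) (0 : ℝ)
        (by simpa using hda) ?_
      simpa using ((hasDerivAt_id (0 : ℝ)).const_mul σ).const_add θ
    have h2 : HasDerivAt (fun s : ℝ => Real.exp (-s * δ)) (Real.exp (-0 * δ) * (-1 * δ)) 0 :=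
      (((hasDerivAt_id (0 : ℝ)).neg).mul_const δ).exp
    have h3 := h1.mul h2
    have hneg : 0 * σ * Real.exp (-0 * δ) +
        truncMGF μ y R (θ + σ * 0) * (Real.exp (-0 * δ) * (-1 * δ)) < 0 := by
      simp
      positivity
    have h4 := (hasDerivAt_iff_tendsto_slope.1 h3).mono_left
      (nhdsWithin_mono (0 : ℝ) (s := Set.Ioi 0) fun s hs => ne_of_gt hs)
    filter_upwards [h4.eventually_lt_const hneg, self_mem_nhdsWithin] with s hs hs0
    rw [slope_def_field, div_lt_iff₀ (by simpa using hs0)] at hs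
    simpa using hs
  obtain ⟨s, ⟨h1, h2⟩, hs⟩ := (((key 1).and (key (-1))).and self_mem_nhdsWithin).exists
  exact ⟨s, hs, by simpa using h1, by simpa [sub_eq_add_neg] using h2⟩

end truncMGF

/-! ### The lower bound by change of measure -/

section Tilting

variable {Ω : Type*} {W : ℕ → Ω → ℝ} {A B : Set ℝ} {y : ℝ} {n : ℕ}

/-- The unnormalized density `exp (θ * ∑ (W i - y))` of the exponential tilting of the first `n`
variables, on the event that these lie in `A` and that the next variable lies in `B`. It is
written as a product so that independence applies directly. -/
noncomputable def tiltWeight (W : ℕ → Ω → ℝ) (A B : Set ℝ) (y : ℝ) (n : ℕ) (θ : ℝ) (ω : Ω) :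
    ENNReal :=
  ∏ i ∈ Finset.range (n + 1), (fun w => if i < n then
    A.indicator (fun w => ENNReal.ofReal (Real.exp (θ * (w - y)))) w
    else B.indicator 1 w) (W i ω)

lemma tiltWeight_eq (θ : ℝ) (ω : Ω) :
    tiltWeight W A B y n θ ω = (∏ i ∈ Finset.range n,
      A.indicator (fun w => ENNReal.ofReal (Real.exp (θ * (w - y)))) (W i ω)) *
      B.indicator 1 (W n ω) := by
  rw [tiltWeight, Finset.prod_range_succ]
  congr 1
  · exact Finset.prod_congr rfl fun i hi => if_pos (Finset.mem_range.1 hi)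
  · simp

lemma tiltWeight_of_mem {ω : Ω} (h : ∀ i < n, W i ω ∈ A) (hB : W n ω ∈ B) (θ : ℝ) :
    tiltWeight W A B y n θ ω =
      ENNReal.ofReal (Real.exp (θ * (∑ i ∈ Finset.range n, W i ω - n * y))) := by
  rw [tiltWeight_eq, Set.indicator_of_mem hB, Pi.one_apply, mul_one,
    Finset.prod_congr rfl fun i hi => Set.indicator_of_mem (h i (Finset.mem_range.1 hi)) _,
    ← ENNReal.ofReal_prod_of_nonneg (fun _ _ => by positivity), ← Real.exp_sum,
    ← Finset.mul_sum, Finset.sum_sub_distrib]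
  simp

lemma tiltWeight_of_notMem {ω : Ω} (h : ¬ ((∀ i < n, W i ω ∈ A) ∧ W n ω ∈ B)) (θ : ℝ) :
    tiltWeight W A B y n θ ω = 0 := by
  rw [tiltWeight_eq]
  by_cases hB : W n ω ∈ B
  · simp only [hB, and_true, not_forall] at h
    obtain ⟨i, hi, hiA⟩ := h
    rw [Finset.prod_eq_zero (Finset.mem_range.2 hi) (Set.indicator_of_notMem hiA _), zero_mul]
  · rw [Set.indicator_of_notMem hB, mul_zero]

/-- The event that the first `n` variables lie in `A`, with mean within `δ` of `y`, and that the
next variable lies in `B`. -/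
def nearMeanEvent (W : ℕ → Ω → ℝ) (A B : Set ℝ) (y δ : ℝ) (n : ℕ) : Set Ω :=
  {ω | (∀ i < n, W i ω ∈ A) ∧ W n ω ∈ B ∧ |∑ i ∈ Finset.range n, W i ω - n * y| < n * δ}

/-- Off the event `nearMeanEvent` the weight is dominated, up to an exponentially small factor,
by the weights with parameters `θ ± s`. -/
lemma tiltWeight_le {s δ : ℝ} (hs : 0 < s) (θ : ℝ) (ω : Ω) :
    tiltWeight W A B y n θ ω ≤
      (nearMeanEvent W A B y δ n).indicator
        (fun _ => ENNReal.ofReal (Real.exp (n * (|θ| * δ)))) ω +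
      ENNReal.ofReal (Real.exp (n * (-s * δ))) *
        (tiltWeight W A B y n (θ + s) ω + tiltWeight W A B y n (θ - s) ω) := by
  by_cases h : (∀ i < n, W i ω ∈ A) ∧ W n ω ∈ B
  swap
  · rw [tiltWeight_of_notMem h]
    exact zero_le
  rw [tiltWeight_of_mem h.1 h.2, tiltWeight_of_mem h.1 h.2, tiltWeight_of_mem h.1 h.2]
  set T := ∑ i ∈ Finset.range n, W i ω - n * y with hT
  by_cases hd : |T| < n * δ
  · rw [Set.indicator_of_mem (show ω ∈ nearMeanEvent W A B y δ n from ⟨h.1, h.2, hd⟩)]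
    refine le_trans (ENNReal.ofReal_le_ofReal (Real.exp_le_exp.2 ?_)) le_self_add
    calc θ * T ≤ |θ| * |T| := by rw [← abs_mul]; exact le_abs_self _
      _ ≤ |θ| * (n * δ) := by gcongr
      _ = n * (|θ| * δ) := by ring
  · refine le_trans ?_ le_add_self
    rw [mul_add, ← ENNReal.ofReal_mul (by positivity), ← ENNReal.ofReal_mul (by positivity),
      ← Real.exp_add, ← Real.exp_add]
    rcases le_abs.1 (not_lt.1 hd) with h1 | h1
    · refine le_trans (ENNReal.ofReal_le_ofReal (Real.exp_le_exp.2 ?_)) le_self_add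
      nlinarith
    · refine le_trans (ENNReal.ofReal_le_ofReal (Real.exp_le_exp.2 ?_)) le_add_self
      nlinarith

variable [MeasurableSpace Ω] {P : Measure Ω}

lemma measurable_tiltWeight (hW : ∀ n, Measurable (W n)) (hA : MeasurableSet A)
    (hB : MeasurableSet B) (θ : ℝ) : Measurable (tiltWeight W A B y n θ) := by
  have : tiltWeight W A B y n θ = fun ω => (∏ i ∈ Finset.range n,
      A.indicator (fun w => ENNReal.ofReal (Real.exp (θ * (w - y)))) (W i ω)) *
      B.indicator 1 (W n ω) := funext fun ω => tiltWeight_eq θ ω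
  rw [this]
  refine (Finset.measurable_fun_prod _ fun i _ => ?_).mul
    ((measurable_one.indicator hB).comp (hW n))
  exact (Measurable.indicator (by fun_prop) hA).comp (hW i)

lemma measurableSet_nearMeanEvent (hW : ∀ n, Measurable (W n)) (hA : MeasurableSet A)
    (hB : MeasurableSet B) (δ : ℝ) : MeasurableSet (nearMeanEvent W A B y δ n) := by
  have h1 : MeasurableSet {ω | ∀ i < n, W i ω ∈ A} := by
    have : {ω | ∀ i < n, W i ω ∈ A} = ⋂ i, ⋂ (_ : i < n), W i ⁻¹' A := by ext; simp
    rw [this]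
    exact MeasurableSet.iInter fun i => MeasurableSet.iInter fun _ => hW i hA
  have h2 : MeasurableSet {ω | |∑ i ∈ Finset.range n, W i ω - n * y| < n * δ} := by
    refine measurableSet_lt ?_ measurable_const
    exact continuous_abs.measurable.comp
      ((Finset.measurable_fun_sum _ fun i _ => hW i).sub_const _)
  exact h1.inter ((hW n hB).inter h2)

lemma lintegral_tiltWeight (hW : ∀ n, Measurable (W n)) (hind : iIndepFun W P) {ν : Measure ℝ}
    (hν : ∀ n, P.map (W n) = ν) (hA : MeasurableSet A) (hB : MeasurableSet B) (θ : ℝ) :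
    ∫⁻ ω, tiltWeight W A B y n θ ω ∂P =
      (∫⁻ w in A, ENNReal.ofReal (Real.exp (θ * (w - y))) ∂ν) ^ n * ν B := by
  simp only [tiltWeight]
  rw [lintegral_prod_comp hW hind hν (Finset.range (n + 1)) (fun i w => if i < n then
    A.indicator (fun w => ENNReal.ofReal (Real.exp (θ * (w - y)))) w
    else B.indicator 1 w), Finset.prod_range_succ]
  · congr 1
    · rw [Finset.prod_congr rfl (g := fun _ =>
        ∫⁻ w in A, ENNReal.ofReal (Real.exp (θ * (w - y))) ∂ν), Finset.prod_const,
        Finset.card_range]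
      intro i hi
      simp only [if_pos (Finset.mem_range.1 hi)]
      rw [lintegral_indicator hA]
    · simp [lintegral_indicator_one hB]
  · intro i
    by_cases hi : i < n
    · simp only [hi, if_true]
      exact Measurable.indicator (by fun_prop) hA
    · simp only [hi, if_false]
      exact measurable_one.indicator hB

/-- The lower bound in Cramér's theorem for the variables conditioned to be at most `b`, for a
value `y` with mass of the law on both sides, and with one more variable put in `B`. -/
lemma eventually_le_measure_nearMeanEvent [IsProbabilityMeasure P] (hW : ∀ n, Measurable (W n))
    (hind : iIndepFun W P) {ν : Measure ℝ} (hν : ∀ n, P.map (W n) = ν) {b : ℝ}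
    (hB : MeasurableSet B) (hνB : ν B ≠ 0) (hr : ν (Set.Ioi y ∩ Set.Iic b) ≠ 0)
    (hl : ν (Set.Iio y ∩ Set.Iic b) ≠ 0) {a δ : ℝ} (hδ : 0 < δ)
    (ha : ∀ θ : ℝ, ENNReal.ofReal (Real.exp (-a)) <
      ∫⁻ w in Set.Iic b, ENNReal.ofReal (Real.exp (θ * (w - y))) ∂ν) :
    ∀ᶠ n : ℕ in atTop, ENNReal.ofReal (Real.exp ((n + 1 : ℕ) * -a)) ≤
      P (nearMeanEvent W (Set.Iic b) B y δ n) := by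
  have hνp : IsProbabilityMeasure ν := hν 0 ▸ Measure.isProbabilityMeasure_map (hW 0).aemeasurable
  set μ := ν.restrict (Set.Iic b) with hμ
  obtain ⟨R, θ, hd, hlt⟩ := exists_truncMGF_critical (μ := μ) (y := y)
    (by rwa [hμ, Measure.restrict_apply measurableSet_Ioi])
    (by rwa [hμ, Measure.restrict_apply measurableSet_Iio]) ha
  set h := truncMGF μ y R with hh
  have hpos : 0 < h θ := (Real.exp_pos _).trans hlt
  -- `δ` is reduced so that the factor `exp (n |θ| δ)` does not spoil the strict inequality.
  obtain ⟨d, hd0, hdδ, hlt'⟩ : ∃ d > 0, d ≤ δ ∧ Real.exp (-a) < h θ * Real.exp (-(|θ| * d)) := by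
    have hc : Tendsto (fun d : ℝ => h θ * Real.exp (-(|θ| * d))) (𝓝[>] 0) (𝓝 (h θ)) := by
      have : Continuous fun d : ℝ => h θ * Real.exp (-(|θ| * d)) := by fun_prop
      simpa using (this.tendsto 0).mono_left nhdsWithin_le_nhds
    obtain ⟨d, h1, h2⟩ := ((hc.eventually_const_lt hlt).and (Ioc_mem_nhdsGT hδ)).exists
    exact ⟨d, h2.1, h2.2, h1⟩
  obtain ⟨s, hs, hs1, hs2⟩ := exists_pos_truncMGF_mul_exp_lt hd0 hd hpos
  set A := Set.Icc (-R) R ∩ Set.Iic b with hA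
  have hAm : MeasurableSet A := measurableSet_Icc.inter measurableSet_Iic
  have hint : ∀ (t : ℝ) (n : ℕ), ∫⁻ ω, tiltWeight W A B y n t ω ∂P =
      ENNReal.ofReal (h t ^ n * ν.real B) := fun t n => by
    have ht : 0 ≤ h t := mgf_nonneg
    rw [lintegral_tiltWeight hW hind hν hAm hB, ENNReal.ofReal_mul (by positivity),
      ENNReal.ofReal_pow ht, ofReal_truncMGF, Measure.restrict_restrict measurableSet_Icc,
      ofReal_measureReal]
  have hp : 0 < ν.real B := (measureReal_nonneg).lt_of_ne' (by
    rwa [Ne, measureReal_eq_zero_iff])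
  set p := ν.real B with hp_def
  have hmain : ∀ n : ℕ, h θ ^ n * p ≤ Real.exp (n * (|θ| * d)) * P.real (nearMeanEvent W A B y d n)
      + Real.exp (n * (-s * d)) * (h (θ + s) ^ n * p + h (θ - s) ^ n * p) := by
    intro n
    have h1 : 0 ≤ h (θ + s) := mgf_nonneg
    have h2 : 0 ≤ h (θ - s) := mgf_nonneg
    rw [← ENNReal.ofReal_le_ofReal_iff (by positivity), ← hint,
      ENNReal.ofReal_add (by positivity) (by positivity), ENNReal.ofReal_mul (by positivity),
      ENNReal.ofReal_mul (by positivity), ENNReal.ofReal_add (by positivity) (by positivity),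
      ← hint, ← hint, ofReal_measureReal]
    refine (lintegral_mono fun ω => tiltWeight_le (δ := d) hs θ ω).trans_eq ?_
    have hE := measurableSet_nearMeanEvent (n := n) (y := y) hW hAm hB d
    rw [lintegral_add_left (measurable_const.indicator hE), lintegral_indicator_const hE,
      lintegral_const_mul' _ _ ENNReal.ofReal_ne_top,
      lintegral_add_left (measurable_tiltWeight hW hAm hB _)]
  have hsmall : ∀ t : ℝ, 0 ≤ h t → h t * Real.exp (-s * d) < h θ →
      ∀ᶠ n : ℕ in atTop, Real.exp (n * (-s * d)) * h t ^ n ≤ h θ ^ n / 4 := by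
    intro t ht0 ht
    have hq := tendsto_pow_atTop_nhds_zero_of_lt_one
      (r := h t * Real.exp (-s * d) / h θ) (by positivity) ((div_lt_one hpos).2 ht)
    filter_upwards [hq.eventually_le_const (show (0 : ℝ) < 1 / 4 by norm_num)] with n hn
    rw [div_pow, div_le_iff₀ (by positivity), mul_pow, ← Real.exp_nat_mul] at hn
    linarith
  have hbig : ∀ᶠ n : ℕ in atTop, Real.exp ((n + 1 : ℕ) * -a) ≤
      (h θ * Real.exp (-(|θ| * d))) ^ n * (p / 2) := by
    have hq := tendsto_pow_atTop_atTop_of_one_lt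
      (r := h θ * Real.exp (-(|θ| * d)) / Real.exp (-a)) ((one_lt_div (Real.exp_pos _)).2 hlt')
    filter_upwards [hq.eventually_ge_atTop (Real.exp (-a) / (p / 2))] with n hn
    rw [div_pow, div_le_div_iff₀ (by positivity) (by positivity), ← Real.exp_nat_mul,
      ← Real.exp_add] at hn
    have he : ((n + 1 : ℕ) : ℝ) * -a = -a + n * -a := by push_cast; ring
    rwa [he]
  filter_upwards [hsmall (θ + s) mgf_nonneg hs1, hsmall (θ - s) mgf_nonneg hs2, hbig]
    with n h1 h2 h3
  have hEsub : nearMeanEvent W A B y d n ⊆ nearMeanEvent W (Set.Iic b) B y δ n :=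
    fun ω hω => ⟨fun i hi => (hω.1 i hi).2, hω.2.1, hω.2.2.trans_le (by gcongr)⟩
  refine le_trans ?_ (measure_mono hEsub)
  rw [← ofReal_measureReal]
  refine ENNReal.ofReal_le_ofReal (h3.trans ?_)
  have h4 : h θ ^ n * (p / 2) ≤
      Real.exp (n * (|θ| * d)) * P.real (nearMeanEvent W A B y d n) := by
    have := hmain n
    nlinarith
  rw [mul_pow, ← Real.exp_nat_mul]
  calc h θ ^ n * Real.exp (n * -(|θ| * d)) * (p / 2)
      = Real.exp (n * -(|θ| * d)) * (h θ ^ n * (p / 2)) := by ring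
    _ ≤ Real.exp (n * -(|θ| * d)) *
        (Real.exp (n * (|θ| * d)) * P.real (nearMeanEvent W A B y d n)) := by gcongr
    _ = P.real (nearMeanEvent W A B y d n) := by
        rw [← mul_assoc, ← Real.exp_add]
        simp

end Tilting

/-! ### The rate function as a Legendre transform -/

/-- The unnormalized moment generating function `∫_{-∞}^z e^{θ w} f(w) dw`. -/
noncomputable def partialMGF (f : ℝ → ℝ) (θ z : ℝ) : ENNReal :=
  ∫⁻ w in Set.Iic z, ENNReal.ofReal (Real.exp (θ * w) * f w)

/-- The Legendre transform at `y` of `θ ↦ log ∫_{-∞}^z e^{θ w} f(w) dw`. -/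
noncomputable def legendreRate (f : ℝ → ℝ) (y z : ℝ) : EReal :=
  ⨆ θ : ℝ, (((θ * y : ℝ) : EReal) - ENNReal.log (partialMGF f θ z))

section PartialMGF

variable {f : ℝ → ℝ}

lemma cdfOf_eq_partialMGF (z : ℝ) : cdfOf f z = partialMGF f 0 z := by
  simp [cdfOf, partialMGF]

lemma partialMGF_eq_zero {m : EReal} {M : ℝ} (hf_zero : ∀ w : ℝ, w ∉ clInterval m M → f w = 0)
    {z : ℝ} (hz : (z : EReal) ≤ m) (θ : ℝ) : partialMGF f θ z = 0 := by
  rw [partialMGF, restrict_Iio_eq_restrict_Iic.symm]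
  rw [setLIntegral_eq_zero measurableSet_Iio]
  intro w hw
  have : f w = 0 := hf_zero w fun h =>
    absurd (h.1.trans_lt (EReal.coe_lt_coe_iff.2 hw)) (not_lt.2 hz)
  simp [this]

lemma setLIntegral_exp_withDensity (hf : Measurable f) (θ z : ℝ) :
    ∫⁻ w in Set.Iic z, ENNReal.ofReal (Real.exp (θ * w))
      ∂(volume.withDensity fun w => ENNReal.ofReal (f w)) = partialMGF f θ z := by
  rw [setLIntegral_withDensity_eq_setLIntegral_mul _ (by fun_prop) (by fun_prop)
    measurableSet_Iic, partialMGF]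
  refine lintegral_congr fun w => ?_
  rw [Pi.mul_apply, mul_comm, ENNReal.ofReal_mul (by positivity)]

/-- Since `f` is integrable, the finiteness of the unnormalized moment generating function does
not depend on the cutoff. -/
lemma partialMGF_ne_top (hfi : ∫⁻ w, ENNReal.ofReal (f w) ≠ ⊤) {θ z : ℝ}
    (h : partialMGF f θ z ≠ ⊤) (z' : ℝ) : partialMGF f θ z' ≠ ⊤ := by
  have hb : ∫⁻ w in Set.Ioc z z', ENNReal.ofReal (Real.exp (θ * w) * f w) ≠ ⊤ := by
    refine ne_top_of_le_ne_top (ENNReal.mul_ne_top (ENNReal.ofReal_ne_top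
      (r := Real.exp (|θ| * max |z| |z'|))) hfi) ?_
    rw [← lintegral_const_mul' _ _ ENNReal.ofReal_ne_top]
    refine (setLIntegral_mono' measurableSet_Ioc fun w hw => ?_).trans
      (setLIntegral_le_lintegral _ _)
    rw [ENNReal.ofReal_mul (by positivity)]
    refine mul_le_mul_left (ENNReal.ofReal_le_ofReal (Real.exp_le_exp.2 ?_)) _
    calc θ * w ≤ |θ| * |w| := by rw [← abs_mul]; exact le_abs_self _
      _ ≤ |θ| * max |z| |z'| := by
        gcongr
        exact abs_le_max_abs_abs hw.1.le hw.2
  refine ne_top_of_le_ne_top (ENNReal.add_ne_top.2 ⟨h, hb⟩) ?_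
  refine (lintegral_mono_set fun w hw => ?_).trans (lintegral_union_le _ _ _)
  rcases le_or_gt w z with h1 | h1
  · exact Or.inl h1
  · exact Or.inr ⟨h1, hw⟩

lemma continuous_partialMGF (hf : Measurable f) (hfi : ∫⁻ w, ENNReal.ofReal (f w) ≠ ⊤) (θ : ℝ) :
    Continuous (partialMGF f θ) := by
  by_cases h : ∃ z, partialMGF f θ z ≠ ⊤
  swap
  · push Not at h
    rw [show partialMGF f θ = fun _ => ⊤ from funext h]
    exact continuous_const
  obtain ⟨z₀, hz₀⟩ := h
  refine continuous_iff_continuousAt.2 fun z => ?_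
  have hG : ∀ x, partialMGF f θ x = ∫⁻ w, (Set.Iic x).indicator
      (fun w => ENNReal.ofReal (Real.exp (θ * w) * f w)) w := fun x => by
    rw [partialMGF, lintegral_indicator measurableSet_Iic]
  rw [ContinuousAt, hG z, show partialMGF f θ = _ from funext hG]
  refine tendsto_lintegral_filter_of_dominated_convergence ((Set.Iic (z + 1)).indicator
      (fun w => ENNReal.ofReal (Real.exp (θ * w) * f w)))
    (Eventually.of_forall fun x => Measurable.indicator (by fun_prop) measurableSet_Iic)
    ?_ (by rw [← hG]; exact partialMGF_ne_top hfi hz₀ _) ?_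
  · filter_upwards [eventually_le_nhds (lt_add_one z)] with x hx
    exact ae_of_all _ fun w => Set.indicator_le_indicator_of_subset
      (Set.Iic_subset_Iic.2 hx) (fun _ => zero_le) w
  · have hne : ∀ᵐ w : ℝ, w ≠ z := by simp [ae_iff]
    filter_upwards [hne] with w hw
    refine tendsto_const_nhds.congr' ?_
    rcases lt_or_gt_of_ne hw with h1 | h1
    · filter_upwards [eventually_ge_nhds h1] with x hx
      rw [Set.indicator_of_mem (show w ∈ Set.Iic x from hx), Set.indicator_of_mem
        (show w ∈ Set.Iic z from h1.le)]
    · filter_upwards [eventually_lt_nhds h1] with x hx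
      rw [Set.indicator_of_notMem (show w ∉ Set.Iic x from not_le.2 hx),
        Set.indicator_of_notMem (show w ∉ Set.Iic z from not_le.2 h1)]

/-- The threshold form of the Legendre transform, free of extended real arithmetic. -/
lemma coe_lt_legendreRate_iff {a y z : ℝ} : (a : EReal) < legendreRate f y z ↔
    ∃ θ : ℝ, partialMGF f θ z < ENNReal.ofReal (Real.exp (θ * y - a)) := by
  rw [legendreRate, lt_iSup_iff]
  refine exists_congr fun θ => ?_
  rw [← ENNReal.log_lt_log_iff, ENNReal.log_ofReal_of_pos (Real.exp_pos _), Real.log_exp]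
  induction ENNReal.log (partialMGF f θ z) using EReal.rec with
  | bot => simp only [EReal.coe_sub_bot, EReal.coe_lt_top, EReal.bot_lt_coe]
  | top => simp
  | coe x =>
    rw [← EReal.coe_sub, EReal.coe_lt_coe_iff, EReal.coe_lt_coe_iff]
    constructor <;> intro h <;> linarith

/-- A bound on the Legendre transform survives a small change of both variables; this serves both
the semicontinuity of the rate function and the local upper bound. -/
lemma exists_partialMGF_add_lt (hf : Measurable f) (hfi : ∫⁻ w, ENNReal.ofReal (f w) ≠ ⊤)
    {a y z : ℝ} (h : (a : EReal) < legendreRate f y z) :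
    ∃ θ : ℝ, ∃ ε > 0, partialMGF f θ (z + ε) < ENNReal.ofReal (Real.exp (θ * y - ε - a)) := by
  obtain ⟨θ, hθ⟩ := coe_lt_legendreRate_iff.1 h
  have h1 : Continuous fun ε : ℝ => partialMGF f θ (z + ε) :=
    (continuous_partialMGF hf hfi θ).comp (by fun_prop)
  have h2 : Continuous fun ε : ℝ => ENNReal.ofReal (Real.exp (θ * y - ε - a)) :=
    ENNReal.continuous_ofReal.comp (by fun_prop)
  have h3 : ∀ᶠ ε in 𝓝 (0 : ℝ),
      partialMGF f θ (z + ε) < ENNReal.ofReal (Real.exp (θ * y - ε - a)) :=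
    h1.continuousAt.eventually_lt h2.continuousAt (by simpa using hθ)
  obtain ⟨ε, hε, hε0⟩ := ((h3.filter_mono nhdsWithin_le_nhds).and
    (self_mem_nhdsWithin (s := Set.Ioi (0 : ℝ)))).exists
  exact ⟨θ, ε, hε0, hε⟩

lemma partialMGF_mono (θ : ℝ) : Monotone (partialMGF f θ) := fun _ _ h =>
  lintegral_mono_set (Set.Iic_subset_Iic.2 h)

lemma lowerSemicontinuous_legendreRate (hf : Measurable f)
    (hfi : ∫⁻ w, ENNReal.ofReal (f w) ≠ ⊤) :
    LowerSemicontinuous fun p : ℝ × ℝ => legendreRate f p.1 p.2 := by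
  rintro ⟨y, z⟩ c hc
  obtain ⟨a, hca, ha⟩ := EReal.lt_iff_exists_real_btwn.1 hc
  obtain ⟨θ, ε, hε, h⟩ := exists_partialMGF_add_lt hf hfi ha
  have h1 : ∀ᶠ p : ℝ × ℝ in 𝓝 (y, z), θ * y - ε < θ * p.1 :=
    (show Continuous fun p : ℝ × ℝ => θ * p.1 by fun_prop).continuousAt.eventually_const_lt
      (by simpa using hε)
  have h2 : ∀ᶠ p : ℝ × ℝ in 𝓝 (y, z), p.2 < z + ε :=
    continuous_snd.continuousAt.eventually_lt_const (by simpa using hε)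
  filter_upwards [h1, h2] with p hp1 hp2
  refine hca.trans (coe_lt_legendreRate_iff.2 ⟨θ, ?_⟩)
  refine ((partialMGF_mono θ hp2.le).trans_lt h).trans_le ?_
  gcongr

lemma rateYZ_eq_legendreRate {m : EReal} {M : ℝ}
    (hf_zero : ∀ w : ℝ, w ∉ clInterval m M → f w = 0)
    (hpos : ∀ z : ℝ, m < (z : EReal) → z ≤ M → cdfOf f z ≠ 0)
    (hfin : ∀ z, cdfOf f z ≠ ⊤) (p : clInterval m M × clInterval m M) :
    rateYZ m M f p = legendreRate f p.1 p.2 := by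
  obtain ⟨⟨y, hy⟩, ⟨z, hz⟩⟩ := p
  simp only [rateYZ, legendreRate]
  rcases hz.1.eq_or_lt with h | h
  -- At `z = m` both sides are `⊤`; on the left this needs that the first summand is not `⊥`.
  · have h0 := partialMGF_eq_zero hf_zero h.ge
    have hb : rateYgivenZ m f y z ≠ ⊥ := by
      refine ne_bot_of_le_ne_bot (b := ((0 : ℝ) : EReal)) (EReal.coe_ne_bot _) ?_
      refine le_trans ?_ (le_iSup _ (0 : ℝ))
      simp [kappa, h]
    simp only [rateZ, cdfOf_eq_partialMGF, h0, ENNReal.log_zero, EReal.neg_bot,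
      EReal.add_top_of_ne_bot hb, EReal.coe_sub_bot, ciSup_const]
  · have hne : (z : EReal) ≠ m := h.ne'
    have hF : ENNReal.log (cdfOf f z) = ((Real.log (cdfOf f z).toReal : ℝ) : EReal) :=
      ENNReal.log_pos_real (hpos z h hz.2) (hfin z)
    set r := Real.log (cdfOf f z).toReal
    have hterm : ∀ θ : ℝ, ((θ * y : ℝ) : EReal) - kappa m f z θ =
        (((θ * y : ℝ) : EReal) - ENNReal.log (partialMGF f θ z)) + (r : EReal) := by
      intro θ
      rw [kappa, if_neg hne, div_eq_mul_inv, ENNReal.log_mul_add, ENNReal.log_inv, hF,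
        ← partialMGF]
      induction ENNReal.log (partialMGF f θ z) using EReal.rec with
      | bot => rw [EReal.bot_add, EReal.coe_sub_bot, EReal.top_add_coe]
      | top => simp [← EReal.coe_neg]
      | coe x =>
        norm_cast
        ring
    simp only [rateYgivenZ, rateZ, hF, hterm]
    rw [← sub_eq_add_neg]
    refine le_antisymm (EReal.sub_le_of_le_add (iSup_le fun θ => ?_)) (iSup_le fun θ => ?_)
    · gcongr
      exact le_iSup (fun θ : ℝ => ((θ * y : ℝ) : EReal) - ENNReal.log (partialMGF f θ z)) θ
    · rw [EReal.le_sub_iff_add_le (by simp) (by simp)]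
      exact le_iSup (fun θ : ℝ =>
        ((θ * y : ℝ) : EReal) - ENNReal.log (partialMGF f θ z) + (r : EReal)) θ

end PartialMGF

/-! ### Sample mean, sample maximum and their joint law -/

section Sample

variable {Ω : Type*} {W : ℕ → Ω → ℝ} {n : ℕ} {ω : Ω}

lemma le_sampleMax {i : ℕ} (hi : i < n) : W i ω ≤ sampleMax W n ω :=
  le_ciSup (f := fun i : Fin n => W i ω) (Set.finite_range _).bddAbove ⟨i, hi⟩

lemma sampleMax_le (hn : 0 < n) {b : ℝ} (h : ∀ i < n, W i ω ≤ b) : sampleMax W n ω ≤ b :=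
  have : Nonempty (Fin n) := ⟨⟨0, hn⟩⟩
  ciSup_le fun i => h i i.2

lemma sampleMean_le (hn : 0 < n) {b : ℝ} (h : ∀ i < n, W i ω ≤ b) : sampleMean W n ω ≤ b := by
  have hn' : (0 : ℝ) < n := by exact_mod_cast hn
  rw [sampleMean, div_le_iff₀ hn']
  refine (Finset.sum_le_card_nsmul _ _ b fun i hi => h i (Finset.mem_range.1 hi)).trans_eq ?_
  simp [mul_comm]

lemma le_sampleMean (hn : 0 < n) {b : ℝ} (h : ∀ i < n, b ≤ W i ω) : b ≤ sampleMean W n ω := by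
  have hn' : (0 : ℝ) < n := by exact_mod_cast hn
  rw [sampleMean, le_div_iff₀ hn']
  refine Eq.trans_le ?_
    (Finset.card_nsmul_le_sum _ _ b fun i hi => h i (Finset.mem_range.1 hi))
  simp [mul_comm]

lemma sampleMean_le_sampleMax (hn : 0 < n) : sampleMean W n ω ≤ sampleMax W n ω :=
  sampleMean_le hn fun _ hi => le_sampleMax hi

lemma sampleMean_mem_clInterval {m : EReal} {M : ℝ} (hn : 0 < n)
    (h : ∀ i < n, W i ω ∈ clInterval m M) : sampleMean W n ω ∈ clInterval m M := by
  refine ⟨?_, sampleMean_le hn fun i hi => (h i hi).2⟩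
  induction m using EReal.rec with
  | bot => exact bot_le
  | top => exact absurd (h 0 hn).1 (by simp)
  | coe x =>
    exact EReal.coe_le_coe_iff.2 (le_sampleMean hn fun i hi => EReal.coe_le_coe_iff.1 (h i hi).1)

lemma sampleMax_mem_clInterval {m : EReal} {M : ℝ} (hn : 0 < n)
    (h : ∀ i < n, W i ω ∈ clInterval m M) : sampleMax W n ω ∈ clInterval m M :=
  ⟨(h 0 hn).1.trans (EReal.coe_le_coe_iff.2 (le_sampleMax hn)),
    sampleMax_le hn fun i hi => (h i hi).2⟩

variable [MeasurableSpace Ω]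

lemma measurable_sampleMean_sampleMax (hW : ∀ n, Measurable (W n)) (n : ℕ) :
    Measurable fun ω => (sampleMean W n ω, sampleMax W n ω) :=
  ((Finset.measurable_fun_sum _ fun i _ => hW i).div_const _).prodMk
    (Measurable.iSup fun i : Fin n => hW i)

end Sample

section ClInterval

variable {m : EReal} {M : ℝ}

lemma isClosed_clInterval : IsClosed (clInterval m M) :=
  (isClosed_le continuous_const continuous_coe_real_ereal).inter
    (isClosed_le continuous_id continuous_const)

lemma isClosedEmbedding_coe_prod : IsClosedEmbedding
    (fun p : clInterval m M × clInterval m M => ((p.1 : ℝ), (p.2 : ℝ))) :=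
  isClosed_clInterval.isClosedEmbedding_subtypeVal.prodMap
    isClosed_clInterval.isClosedEmbedding_subtypeVal

lemma measurableEmbedding_coe_prod : MeasurableEmbedding
    (fun p : clInterval m M × clInterval m M => ((p.1 : ℝ), (p.2 : ℝ))) :=
  (MeasurableEmbedding.subtype_coe isClosed_clInterval.measurableSet).prodMap
    (MeasurableEmbedding.subtype_coe isClosed_clInterval.measurableSet)

lemma isCompact_setOf_ge (R : ℝ) :
    IsCompact {p : clInterval m M × clInterval m M | -R ≤ (p.1 : ℝ) ∧ -R ≤ (p.2 : ℝ)} := by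
  convert isClosedEmbedding_coe_prod.isCompact_preimage
    ((isCompact_Icc (a := -R) (b := M)).prod (isCompact_Icc (a := -R) (b := M))) using 1
  ext p
  simp only [Set.mem_ofPred_eq, Set.mem_preimage, Set.mem_prod, Set.mem_Icc]
  exact ⟨fun h => ⟨⟨h.1, p.1.2.2⟩, ⟨h.2, p.2.2.2⟩⟩, fun h => ⟨h.1.1, h.2.1⟩⟩

end ClInterval

/-- The variables `W 0, W 1, …` are i.i.d. with density `f`, which is positive on `(m, M)` and
vanishes off its closure. -/
structure IsIIDWithDensity {Ω : Type*} [MeasurableSpace Ω] (P : Measure Ω) (m : EReal) (M : ℝ)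
    (f : ℝ → ℝ) (W : ℕ → Ω → ℝ) : Prop where
  measurable_density : Measurable f
  pos : ∀ w : ℝ, m < (w : EReal) → w < M → 0 < f w
  zero : ∀ w : ℝ, w ∉ clInterval m M → f w = 0
  measurable : ∀ n, Measurable (W n)
  indep : iIndepFun W P
  law : ∀ n, P.map (W n) = volume.withDensity fun w => ENNReal.ofReal (f w)

namespace IsIIDWithDensity

variable {Ω : Type*} [MeasurableSpace Ω] {P : Measure Ω} {m : EReal} {M : ℝ} {f : ℝ → ℝ}
  {W : ℕ → Ω → ℝ}

lemma jointLaw_apply (h : IsIIDWithDensity P m M f W)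
    {S : Set (clInterval m M × clInterval m M)} (hS : MeasurableSet S) (n : ℕ) :
    jointLaw P W m M n S =
      P {ω | ∃ p ∈ S, (p.1 : ℝ) = sampleMean W n ω ∧ (p.2 : ℝ) = sampleMax W n ω} := by
  rw [jointLaw, measurableEmbedding_coe_prod.comap_apply,
    Measure.map_apply (measurable_sampleMean_sampleMax h.measurable n)
      (measurableEmbedding_coe_prod.measurableSet_image.2 hS)]
  congr 1
  ext ω
  simp [Set.mem_image]

lemma ae_mem_clInterval (h : IsIIDWithDensity P m M f W) :
    ∀ᵐ ω ∂P, ∀ i, W i ω ∈ clInterval m M := by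
  refine ae_all_iff.2 fun i => ?_
  have : ∀ᵐ w ∂(P.map (W i)), w ∈ clInterval m M := by
    rw [h.law i, ae_withDensity_iff (by have := h.measurable_density; fun_prop)]
    refine ae_of_all _ fun w hw => ?_
    by_contra hcon
    simp [h.zero w hcon] at hw
  exact ae_of_ae_map (h.measurable i).aemeasurable this

/-- Every nonempty interval that ends in `(m, M]` is charged. -/
lemma withDensity_Ioo_ne_zero (h : IsIIDWithDensity P m M f W) {u v : ℝ} (huv : u < v)
    (hm : m < (v : EReal)) (hM : v ≤ M) :
    (volume.withDensity fun w => ENNReal.ofReal (f w)) (Set.Ioo u v) ≠ 0 := by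
  obtain ⟨x, hx, hxv⟩ := EReal.lt_iff_exists_real_btwn.1
    (max_lt (EReal.coe_lt_coe_iff.2 huv) hm)
  have hxv' : x < v := EReal.coe_lt_coe_iff.1 hxv
  have hux : u < x := EReal.coe_lt_coe_iff.1 ((le_max_left _ _).trans_lt hx)
  have hmx : m < (x : EReal) := (le_max_right _ _).trans_lt hx
  rw [withDensity_apply _ measurableSet_Ioo]
  refine ((setLIntegral_pos_iff (by have := h.measurable_density; fun_prop)).2 ?_).ne'
  refine lt_of_lt_of_le (by simpa using hxv') (measure_mono (s := Set.Ioo x v) fun w hw => ?_)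
  have hfw := h.pos w (hmx.trans (EReal.coe_lt_coe_iff.2 hw.1)) (hw.2.trans_le hM)
  exact ⟨by simpa using hfw, hux.trans hw.1, hw.2⟩

lemma lintegral_density [IsProbabilityMeasure P] (h : IsIIDWithDensity P m M f W) :
    ∫⁻ w, ENNReal.ofReal (f w) = 1 := by
  have := Measure.isProbabilityMeasure_map (μ := P) (h.measurable 0).aemeasurable
  rw [h.law 0] at this
  rw [← this.measure_univ, withDensity_apply _ MeasurableSet.univ, Measure.restrict_univ]

lemma lintegral_density_ne_top [IsProbabilityMeasure P] (h : IsIIDWithDensity P m M f W) :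
    ∫⁻ w, ENNReal.ofReal (f w) ≠ ⊤ := by simp [h.lintegral_density]

lemma isProbabilityMeasure_jointLaw [IsProbabilityMeasure P] (h : IsIIDWithDensity P m M f W)
    {n : ℕ} (hn : 0 < n) :
    IsProbabilityMeasure (jointLaw P W m M n) := by
  refine ⟨?_⟩
  rw [h.jointLaw_apply MeasurableSet.univ, ← measure_univ (μ := P)]
  refine measure_congr (eventuallyEq_univ.2 ?_)
  filter_upwards [h.ae_mem_clInterval] with ω hω
  exact ⟨(⟨_, sampleMean_mem_clInterval hn fun i _ => hω i⟩,
    ⟨_, sampleMax_mem_clInterval hn fun i _ => hω i⟩), trivial, rfl, rfl⟩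

lemma rateYZ_eq [IsProbabilityMeasure P] (h : IsIIDWithDensity P m M f W)
    (p : clInterval m M × clInterval m M) :
    rateYZ m M f p = legendreRate f p.1 p.2 := by
  refine rateYZ_eq_legendreRate h.zero (fun z hz hzM h0 => ?_) (fun z => ?_) p
  · refine h.withDensity_Ioo_ne_zero (sub_one_lt z) hz hzM ?_
    rw [withDensity_apply _ measurableSet_Ioo, ← nonpos_iff_eq_zero, ← h0]
    exact lintegral_mono_set fun w hw => hw.2.le
  · exact ne_top_of_le_ne_top h.lintegral_density_ne_top (setLIntegral_le_lintegral _ _)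

lemma isRateFunction [IsProbabilityMeasure P] (h : IsIIDWithDensity P m M f W) :
    IsRateFunction (rateYZ m M f) := by
  constructor
  · intro p
    rw [h.rateYZ_eq]
    refine le_trans ?_ (le_iSup _ (0 : ℝ))
    rw [← cdfOf_eq_partialMGF]
    have : ENNReal.log (cdfOf f p.2) ≤ 0 := ENNReal.log_le_zero_iff.2
      ((setLIntegral_le_lintegral _ _).trans_eq h.lintegral_density)
    simpa using this
  · rw [show rateYZ m M f = _ from funext h.rateYZ_eq]
    exact (lowerSemicontinuous_legendreRate h.measurable_density h.lintegral_density_ne_top).comp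
      (g := fun p : clInterval m M × clInterval m M => ((p.1 : ℝ), (p.2 : ℝ)))
      isClosedEmbedding_coe_prod.continuous

/-! ### The upper bound -/

/-- Chernoff's bound for the joint law. The constraint on `S` is only needed where `y ≤ z`, since
the mean is at most the maximum. -/
lemma jointLaw_le_exp (h : IsIIDWithDensity P m M f W)
    {S : Set (clInterval m M × clInterval m M)} (hS : MeasurableSet S) {n : ℕ} (hn : 0 < n)
    {θ b c a : ℝ} (hSub : ∀ p ∈ S, (p.1 : ℝ) ≤ p.2 → c ≤ θ * p.1 ∧ (p.2 : ℝ) ≤ b)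
    (hle : partialMGF f θ b ≤ ENNReal.ofReal (Real.exp (c - a))) :
    jointLaw P W m M n S ≤ ENNReal.ofReal (Real.exp (n * -a)) := by
  have hn' : (0 : ℝ) < n := by exact_mod_cast hn
  rw [h.jointLaw_apply hS]
  refine (measure_mono ?_).trans ((measure_sum_ge_le h.measurable h.indep h.law n θ b c).trans ?_)
  · rintro ω ⟨p, hp, h1, h2⟩
    obtain ⟨h3, h4⟩ := hSub p hp (by rw [h1, h2]; exact sampleMean_le_sampleMax hn)
    refine ⟨?_, fun i hi => (le_sampleMax hi).trans (h2 ▸ h4)⟩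
    rw [h1, sampleMean, mul_div_assoc', le_div_iff₀ hn'] at h3
    linarith
  · rw [setLIntegral_exp_withDensity h.measurable_density, Real.exp_nat_mul,
      ENNReal.ofReal_pow (by positivity)]
    refine pow_le_pow_left₀ zero_le ?_ n
    calc _ ≤ ENNReal.ofReal (Real.exp (-c)) * ENNReal.ofReal (Real.exp (c - a)) := by gcongr
      _ = ENNReal.ofReal (Real.exp (-a)) := by
        rw [← ENNReal.ofReal_mul (by positivity), ← Real.exp_add]
        ring_nf

lemma exists_nhds_jointLaw_le [IsProbabilityMeasure P] (h : IsIIDWithDensity P m M f W) {a : ℝ}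
    {p : clInterval m M × clInterval m M} (ha : (a : EReal) < rateYZ m M f p) :
    ∃ U ∈ 𝓝 p, ∀ᶠ n : ℕ in atTop,
      jointLaw P W m M n U ≤ ENNReal.ofReal (Real.exp (n * -a)) := by
  rw [h.rateYZ_eq] at ha
  obtain ⟨θ, ε, hε, hlt⟩ :=
    exists_partialMGF_add_lt h.measurable_density h.lintegral_density_ne_top ha
  have hU : IsOpen ({q : clInterval m M × clInterval m M |
      θ * (p.1 : ℝ) - ε < θ * q.1} ∩ {q | (q.2 : ℝ) < p.2 + ε}) :=
    (isOpen_lt (by fun_prop) (by fun_prop)).inter (isOpen_lt (by fun_prop) (by fun_prop))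
  refine ⟨_, hU.mem_nhds ⟨sub_lt_self _ hε, lt_add_of_pos_right _ hε⟩, ?_⟩
  filter_upwards [eventually_gt_atTop 0] with n hn
  exact h.jointLaw_le_exp hU.measurableSet hn (fun q hq _ => ⟨hq.1.le, hq.2.le⟩) hlt.le

/-- Exponential tightness: a negative exponential moment controls the sample mean, and the sample
maximum is at least the sample mean. -/
lemma exists_jointLaw_tail_le (h : IsIIDWithDensity P m M f W) {θ : ℝ} (hθ : θ < 0)
    (hfin : partialMGF f θ M ≠ ⊤) (a : ℝ) :
    ∃ R : ℝ, ∀ n : ℕ, 0 < n → jointLaw P W m M n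
      {p | -R ≤ (p.1 : ℝ) ∧ -R ≤ (p.2 : ℝ)}ᶜ ≤ ENNReal.ofReal (Real.exp (n * -a)) := by
  obtain ⟨R, hR⟩ : ∃ R : ℝ, partialMGF f θ M ≤ ENNReal.ofReal (Real.exp (-θ * R - a)) := by
    have h1 : Tendsto (fun R : ℝ => Real.exp (-θ * R - a)) atTop atTop :=
      Real.tendsto_exp_atTop.comp (tendsto_atTop_add_const_right _ (-a)
        (tendsto_id.const_mul_atTop (neg_pos.2 hθ)))
    obtain ⟨R, hR⟩ := (h1.eventually_ge_atTop (partialMGF f θ M).toReal).exists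
    exact ⟨R, by rw [← ENNReal.ofReal_toReal hfin]; exact ENNReal.ofReal_le_ofReal hR⟩
  refine ⟨R, fun n hn => h.jointLaw_le_exp (isCompact_setOf_ge R).measurableSet.compl hn
    (fun q hq hq' => ⟨?_, q.2.2.2⟩) hR⟩
  have hqR : (q.1 : ℝ) < -R := by
    by_contra hcon
    exact hq ⟨not_lt.1 hcon, (not_lt.1 hcon).trans hq'⟩
  nlinarith

end IsIIDWithDensity

/-! ### The lower bound -/

namespace IsIIDWithDensity

variable {Ω : Type*} [MeasurableSpace Ω] {P : Measure Ω} [IsProbabilityMeasure P] {m : EReal}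
  {M : ℝ} {f : ℝ → ℝ} {W : ℕ → Ω → ℝ}

/-- A point of finite rate satisfies `m < z`, and the law conditioned to be at most `z` charges
both sides of `y`: otherwise some exponential moment about `y` would be arbitrarily small. -/
lemma charges_of_forall_lt_lintegral (h : IsIIDWithDensity P m M f W) {y z : ℝ} {c : ENNReal}
    (hc : 0 < c) (hz : m ≤ (z : EReal)) {ν : Measure ℝ}
    (hν : ν = volume.withDensity fun w => ENNReal.ofReal (f w))
    (ha : ∀ θ : ℝ, c < ∫⁻ w in Set.Iic z, ENNReal.ofReal (Real.exp (θ * (w - y))) ∂ν) :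
    m < (z : EReal) ∧ ν (Set.Ioi y ∩ Set.Iic z) ≠ 0 ∧ ν (Set.Iio y ∩ Set.Iic z) ≠ 0 := by
  have hνp : IsProbabilityMeasure ν := by
    rw [hν, ← h.law 0]
    exact Measure.isProbabilityMeasure_map (h.measurable 0).aemeasurable
  have hne : ∀ᵐ w ∂(ν.restrict (Set.Iic z)), w ≠ y := by
    refine ae_restrict_of_ae ?_
    have : ν {y} = 0 := by
      rw [hν]
      exact withDensity_absolutelyContinuous _ _ (by simp)
    simpa [ae_iff] using this
  refine ⟨lt_of_le_of_ne hz fun hmz => ?_, fun h0 => ?_, fun h0 => ?_⟩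
  · have h0 := ha 0
    have hG := setLIntegral_exp_withDensity h.measurable_density 0 z
    rw [← hν, partialMGF_eq_zero h.zero hmz.ge] at hG
    simp only [zero_mul] at h0 hG
    rw [hG] at h0
    exact not_lt_bot h0
  · obtain ⟨t, ht⟩ := exists_lintegral_exp_mul_lt (μ := ν.restrict (Set.Iic z))
      (φ := fun w => w - y) (by fun_prop) (by
        have : ∀ᵐ w ∂(ν.restrict (Set.Iic z)), w ∉ Set.Ioi y := by
          rw [ae_iff]
          simpa only [not_not, Set.ofPred_mem_eq, Measure.restrict_apply measurableSet_Ioi] using h0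
        filter_upwards [this, hne] with w h1 h2
        exact sub_neg.2 (lt_of_le_of_ne (not_lt.1 h1) h2)) hc
    exact lt_asymm ht (ha t)
  · obtain ⟨t, ht⟩ := exists_lintegral_exp_mul_lt (μ := ν.restrict (Set.Iic z))
      (φ := fun w => y - w) (by fun_prop) (by
        have : ∀ᵐ w ∂(ν.restrict (Set.Iic z)), w ∉ Set.Iio y := by
          rw [ae_iff]
          simpa only [not_not, Set.ofPred_mem_eq, Measure.restrict_apply measurableSet_Iio] using h0
        filter_upwards [this, hne] with w h1 h2
        exact sub_neg.2 (lt_of_le_of_ne (not_lt.1 h1) h2.symm)) hc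
    refine lt_asymm ht ?_
    have he : ∀ w : ℝ, t * (y - w) = -t * (w - y) := fun w => by ring
    simp only [he]
    exact ha (-t)

/-- The lower bound near a point: the last variable is put just below `z`, so that the maximum is
close to `z`, and the others are at most `z` with mean close to `y`. -/
lemma eventually_le_jointLaw (h : IsIIDWithDensity P m M f W)
    {O : Set (clInterval m M × clInterval m M)} (hO : IsOpen O)
    {p : clInterval m M × clInterval m M} (hp : p ∈ O) {a : ℝ}
    (ha : rateYZ m M f p < (a : EReal)) :
    ∀ᶠ n : ℕ in atTop, ENNReal.ofReal (Real.exp (n * -a)) ≤ jointLaw P W m M n O := by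
  rw [h.rateYZ_eq] at ha
  obtain ⟨⟨y, hy⟩, ⟨z, hz⟩⟩ := p
  obtain ⟨a', ha1, ha2⟩ := EReal.lt_iff_exists_real_btwn.1 ha
  have ha2 := EReal.coe_lt_coe_iff.1 ha2
  set ν := volume.withDensity fun w => ENNReal.ofReal (f w) with hν
  have hmgf : ∀ θ : ℝ, ENNReal.ofReal (Real.exp (-a)) <
      ∫⁻ w in Set.Iic z, ENNReal.ofReal (Real.exp (θ * (w - y))) ∂ν := by
    intro θ
    have hle : ENNReal.ofReal (Real.exp (θ * y - a')) ≤ partialMGF f θ z :=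
      not_lt.1 fun hlt => lt_asymm ha1 (coe_lt_legendreRate_iff.2 ⟨θ, hlt⟩)
    calc ENNReal.ofReal (Real.exp (-a)) < ENNReal.ofReal (Real.exp (-a')) :=
          (ENNReal.ofReal_lt_ofReal_iff (Real.exp_pos _)).2 (Real.exp_lt_exp.2 (by linarith))
      _ = ENNReal.ofReal (Real.exp (-(θ * y))) * ENNReal.ofReal (Real.exp (θ * y - a')) := by
          rw [← ENNReal.ofReal_mul (by positivity), ← Real.exp_add]
          ring_nf
      _ ≤ ENNReal.ofReal (Real.exp (-(θ * y))) * partialMGF f θ z := by gcongr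
      _ = _ := by
          rw [← setLIntegral_exp_withDensity h.measurable_density,
            ← lintegral_const_mul' _ _ ENNReal.ofReal_ne_top]
          refine lintegral_congr fun w => ?_
          rw [← ENNReal.ofReal_mul (by positivity), ← Real.exp_add]
          ring_nf
  obtain ⟨hmz, hr, hl⟩ := h.charges_of_forall_lt_lintegral
    (ENNReal.ofReal_pos.2 (Real.exp_pos _)) hz.1 hν hmgf
  obtain ⟨ε, hε, hball⟩ := Metric.isOpen_iff.1 hO _ hp
  have hev := eventually_le_measure_nearMeanEvent h.measurable h.indep h.law
    (B := Set.Ioo (z - ε) z) measurableSet_Ioo (h.withDensity_Ioo_ne_zero (sub_lt_self z hε) hmz hz.2) hr hl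
    (half_pos hε) hmgf
  -- The last variable moves the mean by at most `(|z - y| + ε) / (n + 1)`.
  have hlarge : ∀ᶠ n : ℕ in atTop, 2 * (|z - y| + ε) < (n : ℝ) * ε :=
    (tendsto_natCast_atTop_atTop.atTop_mul_const hε).eventually_gt_atTop _
  suffices hs : ∀ᶠ n : ℕ in atTop, ENNReal.ofReal (Real.exp ((n + 1 : ℕ) * -a)) ≤
      jointLaw P W m M (n + 1) O by
    rw [← map_add_atTop_eq_nat 1]
    exact hs
  filter_upwards [hev, hlarge] with n hn hnε
  refine hn.trans ?_
  rw [h.jointLaw_apply hO.measurableSet]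
  refine measure_mono_ae ?_
  filter_upwards [h.ae_mem_clInterval] with ω hω
  rintro ⟨h1, h2, h3⟩
  have hn0 : 0 < n + 1 := n.succ_pos
  refine ⟨(⟨_, sampleMean_mem_clInterval hn0 fun i _ => hω i⟩,
    ⟨_, sampleMax_mem_clInterval hn0 fun i _ => hω i⟩), hball ?_, rfl, rfl⟩
  have hmax1 : sampleMax W (n + 1) ω ≤ z := sampleMax_le hn0 fun i hi => by
    rcases Nat.lt_succ_iff_lt_or_eq.1 hi with hi | rfl
    · exact h1 i hi
    · exact h2.2.le
  have hmax2 : z - ε < sampleMax W (n + 1) ω := h2.1.trans_le (le_sampleMax n.lt_succ_self)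
  have hmean : |sampleMean W (n + 1) ω - y| < ε := by
    have hn1 : (0 : ℝ) < (n + 1 : ℕ) := by positivity
    rw [sampleMean, div_sub' hn1.ne', abs_div, abs_of_pos hn1, div_lt_iff₀ hn1,
      Finset.sum_range_succ]
    have hWn : |W n ω - y| ≤ |z - y| + ε := by
      have : |W n ω - z| ≤ ε := abs_le.2 ⟨by linarith [h2.1], by linarith [h2.2]⟩
      calc |W n ω - y| = |(z - y) + (W n ω - z)| := by ring_nf
        _ ≤ |z - y| + |W n ω - z| := abs_add_le _ _
        _ ≤ _ := by gcongr
    calc |∑ i ∈ Finset.range n, W i ω + W n ω - ((n + 1 : ℕ) : ℝ) * y|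
        = |(∑ i ∈ Finset.range n, W i ω - n * y) + (W n ω - y)| := by push_cast; ring_nf
      _ ≤ |∑ i ∈ Finset.range n, W i ω - n * y| + |W n ω - y| := abs_add_le _ _
      _ < n * (ε / 2) + (|z - y| + ε) := add_lt_add_of_lt_of_le h3 hWn
      _ < ε * (n + 1 : ℕ) := by push_cast; linarith
  rw [Metric.mem_ball, Prod.dist_eq, max_lt_iff]
  constructor
  · rwa [Subtype.dist_eq, Real.dist_eq]
  · rw [Subtype.dist_eq, Real.dist_eq, abs_lt]
    constructor <;> simp only <;> linarith

/-! ### The large deviation principles -/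

lemma ldpLowerPart (h : IsIIDWithDensity P m M f W) :
    LDPLowerPart (jointLaw P W m M) (fun n => (n : ℝ)) (rateYZ m M f) := by
  refine ⟨fun n hn => h.isProbabilityMeasure_jointLaw hn, tendsto_natCast_atTop_atTop,
    h.isRateFunction, fun O hO => le_liminf_scaledLog fun a ha => ?_⟩
  simp only [iInf_lt_iff] at ha
  obtain ⟨p, hp, hpa⟩ := ha
  exact h.eventually_le_jointLaw hO hp hpa

lemma eventually_jointLaw_le_of_isCompact (h : IsIIDWithDensity P m M f W)
    {K : Set (clInterval m M × clInterval m M)} (hK : IsCompact K) {a : ℝ}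
    (ha : (a : EReal) < ⨅ p ∈ K, rateYZ m M f p) :
    ∀ᶠ n : ℕ in atTop, jointLaw P W m M n K ≤ ENNReal.ofReal (Real.exp (n * -a)) := by
  obtain ⟨b, hab, hb⟩ := EReal.lt_iff_exists_real_btwn.1 ha
  exact eventually_measure_le_of_isCompact hK (EReal.coe_lt_coe_iff.1 hab) fun p hp =>
    h.exists_nhds_jointLaw_le (hb.trans_le (iInf₂_le p hp))

lemma weakLDP (h : IsIIDWithDensity P m M f W) :
    WeakLDP (jointLaw P W m M) (fun n => (n : ℝ)) (rateYZ m M f) :=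
  ⟨h.ldpLowerPart, fun _ hK => limsup_scaledLog_le fun _ ha =>
    h.eventually_jointLaw_le_of_isCompact hK ha⟩

lemma ldp (h : IsIIDWithDensity P m M f W) {θ : ℝ} (hθ : θ < 0) (hfin : partialMGF f θ M ≠ ⊤) :
    LDP (jointLaw P W m M) (fun n => (n : ℝ)) (rateYZ m M f) := by
  refine ⟨h.ldpLowerPart, fun C hC => limsup_scaledLog_le fun a ha => ?_⟩
  obtain ⟨b, hab, hb⟩ := EReal.lt_iff_exists_real_btwn.1 ha
  obtain ⟨R, hR⟩ := h.exists_jointLaw_tail_le hθ hfin b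
  have hcompact := h.eventually_jointLaw_le_of_isCompact ((isCompact_setOf_ge R).inter_left hC)
    (hb.trans_le (biInf_mono fun p hp => hp.1))
  filter_upwards [hcompact, eventually_gt_atTop 0,
    eventually_natCast_mul_exp_le 2 (EReal.coe_lt_coe_iff.1 hab)] with n h1 h2 h3
  refine le_trans ?_ h3
  rw [Nat.cast_two, two_mul]
  exact (measure_le_inter_add_sdiff _ C _).trans
    (add_le_add h1 ((measure_mono (Set.sdiff_subset_compl _ _)).trans (hR n h2)))

end IsIIDWithDensity

/-! ### Contraction to the sample mean -/

/-- Infima of a good rate function over the second coordinate are attained, so that level sets of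
the contracted function are projections of level sets. -/
lemma IsGoodRateFunction.iInf_snd {X Y : Type*} [TopologicalSpace X] [TopologicalSpace Y]
    [T2Space X] {I : X × Y → EReal} (hI : IsGoodRateFunction I) :
    IsGoodRateFunction fun x => ⨅ y, I (x, y) := by
  have hnonneg : ∀ x, 0 ≤ ⨅ y, I (x, y) := fun x => le_iInf fun y => hI.1.1 (x, y)
  have hcompact : ∀ η : ℝ, 0 ≤ η → IsCompact {x | ⨅ y, I (x, y) ≤ (η : EReal)} := by
    intro η hη
    convert (hI.2 η hη).image continuous_fst using 1
    ext x
    simp only [Set.mem_ofPred_eq, Set.mem_image, Prod.exists, exists_and_right, exists_eq_right]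
    refine ⟨fun hx => ?_, fun ⟨y, hy⟩ => (iInf_le _ y).trans hy⟩
    have hlt : ⨅ y, I (x, y) < ((η + 1 : ℝ) : EReal) :=
      hx.trans_lt (EReal.coe_lt_coe_iff.2 (lt_add_one η))
    obtain ⟨y₀, hy₀⟩ := iInf_lt_iff.1 hlt
    have hK : IsCompact ({q : X × Y | I q ≤ ((η + 1 : ℝ) : EReal)} ∩ Prod.fst ⁻¹' {x}) :=
      (hI.2 (η + 1) (by positivity)).inter_right (isClosed_singleton.preimage continuous_fst)
    have hne : ({q : X × Y | I q ≤ ((η + 1 : ℝ) : EReal)} ∩ Prod.fst ⁻¹' {x}).Nonempty :=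
      ⟨(x, y₀), hy₀.le, rfl⟩
    obtain ⟨⟨x', y⟩, ⟨-, hx'⟩, hmin⟩ := LowerSemicontinuousOn.exists_isMinOn hne hK
      (hI.1.2.lowerSemicontinuousOn _)
    obtain rfl : x' = x := hx'
    refine ⟨y, le_trans (le_iInf fun y' => ?_) hx⟩
    by_cases hy' : I (x', y') ≤ ((η + 1 : ℝ) : EReal)
    · exact hmin ⟨hy', rfl⟩
    · exact (hmin ⟨hy₀.le, rfl⟩).trans (hy₀.le.trans (not_le.1 hy').le)
  refine ⟨⟨hnonneg, lowerSemicontinuous_iff_isClosed_preimage.2 fun c => ?_⟩, hcompact⟩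
  rcases lt_or_ge c 0 with hc | hc
  · rw [show (fun x => ⨅ y, I (x, y)) ⁻¹' Set.Iic c = ∅ from
      Set.eq_empty_of_forall_notMem fun x hx => absurd ((hnonneg x).trans hx) (not_le.2 hc)]
    exact isClosed_empty
  · induction c using EReal.rec with
    | bot => exact absurd hc (by simp)
    | top => simp
    | coe η => exact (hcompact η (EReal.coe_nonneg.1 hc)).isClosed

/-- Finiteness of `κ(· | M)` near `0` supplies a negative exponential moment. -/
lemma exists_neg_partialMGF_ne_top {m : EReal} {M : ℝ} {f : ℝ → ℝ} (hmM : m < (M : EReal))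
    (hF : cdfOf f M ≠ ⊤)
    (hκ : ∀ᶠ θ in 𝓝 (0 : ℝ), kappa m f M θ ≠ ⊤) : ∃ θ < 0, partialMGF f θ M ≠ ⊤ := by
  obtain ⟨θ, h1, h2⟩ := ((hκ.filter_mono nhdsWithin_le_nhds).and
    (self_mem_nhdsWithin (s := Set.Iio (0 : ℝ)))).exists
  refine ⟨θ, h2, fun htop => h1 ?_⟩
  rw [kappa, if_neg hmM.ne', ← partialMGF, htop, ENNReal.top_div_of_ne_top hF, ENNReal.log_top]

end SumMaxLDP

theorem mainTheorem3 {Ω : Type*} [MeasurableSpace Ω] (P : MeasureTheory.Measure Ω)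
    [MeasureTheory.IsProbabilityMeasure P]
    (m : EReal) (M : ℝ) (hmM : m < (M : EReal))
    (f : ℝ → ℝ) (hf_meas : Measurable f) (hf_nonneg : ∀ w, 0 ≤ f w)
    (hf_pos : ∀ w : ℝ, m < (w : EReal) → w < M → 0 < f w)
    (hf_zero : ∀ w : ℝ, w ∉ SumMaxLDP.clInterval m M → f w = 0)
    (W : ℕ → Ω → ℝ) (hW_meas : ∀ n, Measurable (W n))
    (hW_indep : ProbabilityTheory.iIndepFun W P)
    (hW_law : ∀ n, P.map (W n) =
      MeasureTheory.volume.withDensity (fun w => ENNReal.ofReal (f w)))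
    (hκ_finite : ∀ z ∈ SumMaxLDP.clInterval m M,
      ∀ᶠ θ in nhds (0 : ℝ), SumMaxLDP.kappa m f z θ ≠ ⊤ ∧ SumMaxLDP.kappa m f z θ ≠ ⊥)
    (hκ_smooth : ∀ z ∈ SumMaxLDP.clInterval m M,
      SumMaxLDP.EssentiallySmooth (SumMaxLDP.kappa m f z))
    (hκ_lsc : ∀ z ∈ SumMaxLDP.clInterval m M,
      LowerSemicontinuous (SumMaxLDP.kappa m f z)) :
    SumMaxLDP.WeakLDP (SumMaxLDP.jointLaw P W m M) (fun n => (n : ℝ))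
      (SumMaxLDP.rateYZ m M f) ∧
    (SumMaxLDP.IsGoodRateFunction (SumMaxLDP.rateYZ m M f) →
      SumMaxLDP.LDP (SumMaxLDP.jointLaw P W m M) (fun n => (n : ℝ))
        (SumMaxLDP.rateYZ m M f) ∧
      SumMaxLDP.IsGoodRateFunction (SumMaxLDP.rateY m M f)) := by
  have h : SumMaxLDP.IsIIDWithDensity P m M f W :=
    ⟨hf_meas, hf_pos, hf_zero, hW_meas, hW_indep, hW_law⟩
  obtain ⟨θ, hθ, hfin⟩ := SumMaxLDP.exists_neg_partialMGF_ne_top hmM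
    (ne_top_of_le_ne_top h.lintegral_density_ne_top (setLIntegral_le_lintegral _ _))
    ((hκ_finite M ⟨hmM.le, le_rfl⟩).mono fun _ hθ => hθ.1)
  exact ⟨h.weakLDP, fun hgood => ⟨h.ldp hθ hfin, hgood.iInf_snd⟩⟩
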